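/- Let $n\ge 1$, let $\mathcal U\subset\mathbb R^n$ be a domain, $T>0$, $Q=\mathcal U\times\,]0,T]$, and let $\alpha<\beta$. Let $f$ be the multivalued function with $f(s)=\{-1\}$ for $s\le\alpha$, $f(s)=\{1\}$ for $s\ge\beta$ and $f(s)=\{-1,1\}$ for $\alpha<s<\beta$. For $u\in C(\overline Q)$ and a prescribed initial state $h_0:\mathcal U\to\{-1,1\}$ with $h_0(x)\in f(u(x,0))$ for all $x\in\mathcal U$, put $E=\{z\in Q: u(z)\le\alpha\}\cup\{z\in Q: u(z)\ge\beta\}\cup(\mathcal U\times\{0\})$ and define $h[u]$ as follows: on $E$, $h[u](x,t)=-1$ if $u(x,t)\le\alpha$, $h[u](x,t)=1$ if $u(x,t)\ge\beta$, and $h[u](x,0)=h_0(x)$ if $\alpha<u(x,0)<\beta$; for $(x,t)\in Q\setminus E$, $h[u](x,t)=h[u](x,\hat t(x))$ with $\hat t(x)=\max\{s\le t:(x,s)\in E\}$. Let $u\in C(\overline Q)\cap W^{2,1}_q(Q)$ with $n+2<q\le\infty$ (that is, $u$ has weak derivatives $Du,D^2u,\partial_tu$ in the interior of $Q$, and $u,D^2u,\partial_tu\in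 L^q(Q)$) be a strong solution of $\Delta u-\partial_tu=h[u]$, i.e. the equation holds a.e. in $Q$. Let $\Omega_\pm=\{z\in Q: h[u](z)=\pm1\}$ and let $\Gamma(u)=\partial\Omega_+\cap\partial\Omega_-$ be the free boundary. Let $\Gamma_v$ be its vertical part: the set of all $(x,t)\in\Gamma(u)$ for which there are $a<b$ with $a\le t\le b$ such that $\{x\}\times\,]a,b[\,\subset\Gamma(u)\cap\{\alpha<u<\beta\}$. Then for every direction $e\in\mathbb R^n$, $|e|=1$, the functions $(D_eu)_+=\max\{D_eu,0\}$ and $(D_eu)_-=\max\{-D_eu,0\}$, where $D_eu=\sum_{i=1}^n e_iD_iu$, are sub-caloric in $Q\setminus\Gamma_v$. Here a function $v$ is sub-caloric in a set $D\subset\mathbb R^{n+1}$ if it is locally integrable in the interior of $D$ and $\Delta v-\partial_tv\ge0$ there in the sense of distributions, i.e. $\int v\,(\partial_t\eta+\Delta\eta)\,dz\ge0$ for all nonnegative $\eta\in C_0^\infty(\operatorname{int}D)$. -/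

import Mathlib

open MeasureTheory Set
open scoped ContDiff ENNReal

noncomputable section

namespace Hysteresis

/-- Space-time `ℝⁿ × ℝ`, with points `z = (x, t)`. The measure `volume` on it is the
`(n+1)`-dimensional Lebesgue measure. -/
abbrev SpaceTime (n : ℕ) : Type := EuclideanSpace ℝ (Fin n) × ℝ

variable {n : ℕ}

/-! ### Distributional calculus in space-time -/

/-- The space-time vector `(e, 0)` of a spatial vector `e`. -/
def spaceDir (e : EuclideanSpace ℝ (Fin n)) : SpaceTime n := (e, 0)

/-- The `i`-th spatial coordinate vector, as a space-time vector. -/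
def coordDir (i : Fin n) : SpaceTime n := spaceDir (EuclideanSpace.single i 1)

/-- The space-time unit vector in the direction of time. -/
def timeDir : SpaceTime n := (0, 1)

/-- The (classical) derivative of `η` in the space-time direction `v`. -/
def dirDeriv (v : SpaceTime n) (η : SpaceTime n → ℝ) (z : SpaceTime n) : ℝ :=
  fderiv ℝ η z v

/-- The adjoint heat operator `∂ₜη + Δη`, with `Δ` the spatial Laplacian. -/
def adjointHeat (η : SpaceTime n → ℝ) (z : SpaceTime n) : ℝ :=
  dirDeriv timeDir η z + ∑ i : Fin n, dirDeriv (coordDir i) (dirDeriv (coordDir i) η) z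

/-- `η` is a test function of class `C₀^∞` for the interior of `D`. -/
def IsTestFunction (D : Set (SpaceTime n)) (η : SpaceTime n → ℝ) : Prop :=
  ContDiff ℝ ∞ η ∧ HasCompactSupport η ∧ tsupport η ⊆ interior D

/-- `g` is the weak derivative of `f` in the direction `v` in (the interior of) `D`. -/
def HasWeakDeriv (D : Set (SpaceTime n)) (f : SpaceTime n → ℝ) (v : SpaceTime n)
    (g : SpaceTime n → ℝ) : Prop :=
  LocallyIntegrableOn f (interior D) ∧ LocallyIntegrableOn g (interior D) ∧
    ∀ η : SpaceTime n → ℝ, IsTestFunction D η →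
      ∫ z, f z * dirDeriv v η z = -∫ z, g z * η z

/-- `u` belongs to the anisotropic Sobolev space `W^{2,1}_q(D)`, with weak spatial gradient `Du`,
weak spatial Hessian `D2u` and weak time derivative `ut`. -/
structure MemW21 (D : Set (SpaceTime n)) (q : ℝ≥0∞) (u : SpaceTime n → ℝ)
    (Du : Fin n → SpaceTime n → ℝ) (D2u : Fin n → Fin n → SpaceTime n → ℝ)
    (ut : SpaceTime n → ℝ) : Prop where
  memLp : MemLp u q (volume.restrict D)
  weak_grad : ∀ i, HasWeakDeriv D u (coordDir i) (Du i)
  weak_hess : ∀ i j, HasWeakDeriv D (Du i) (coordDir j) (D2u i j)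
  weak_time : HasWeakDeriv D u timeDir ut
  memLp_hess : ∀ i j, MemLp (D2u i j) q (volume.restrict D)
  memLp_time : MemLp ut q (volume.restrict D)

/-- `v` is sub-caloric in `D`: it is locally integrable and `H[v] = Δv - ∂ₜv ≥ 0` in the sense of
distributions, i.e. against all nonnegative test functions. -/
def SubCaloricOn (v : SpaceTime n → ℝ) (D : Set (SpaceTime n)) : Prop :=
  LocallyIntegrableOn v (interior D) ∧
    ∀ η : SpaceTime n → ℝ, IsTestFunction D η → (∀ z, 0 ≤ η z) →
      0 ≤ ∫ z, v z * adjointHeat η z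

/-! ### The hysteresis operator -/

/-- The cylinder `Q = U × ]0, T]`. -/
def cylinder (U : Set (EuclideanSpace ℝ (Fin n))) (T : ℝ) : Set (SpaceTime n) := U ×ˢ Ioc 0 T

/-- The multivalued function `f` with thresholds `α < β`: the set of its values at `s`. -/
def relay (α β s : ℝ) : Set ℝ :=
  {y | (s ≤ α ∧ y = -1) ∨ (β ≤ s ∧ y = 1) ∨ (α < s ∧ s < β ∧ (y = -1 ∨ y = 1))}

/-- The set `E` where the value of `f(u)` is determined (on the bottom `U × {0}` it is
prescribed). -/
def determinedSet (U : Set (EuclideanSpace ℝ (Fin n))) (T α β : ℝ) (u : SpaceTime n → ℝ) :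
    Set (SpaceTime n) :=
  {z | z ∈ cylinder U T ∧ u z ≤ α} ∪ {z | z ∈ cylinder U T ∧ β ≤ u z} ∪ U ×ˢ {0}

/-- The value of `f(u)` on `determinedSet`; `h₀` is the prescribed selection of `f(u(·, 0))`. -/
def determinedValue (α β : ℝ) (u : SpaceTime n → ℝ) (h₀ : EuclideanSpace ℝ (Fin n) → ℝ)
    (z : SpaceTime n) : ℝ :=
  if u z ≤ α then -1 else if β ≤ u z then 1 else h₀ z.1

/-- The last time `t̂(x) = max {s ≤ t : (x, s) ∈ E}`, for `z = (x, t)`. For `u` continuous and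
`x ∈ U`, `0 ≤ t ≤ T`, this supremum is a maximum. -/
def lastTime (U : Set (EuclideanSpace ℝ (Fin n))) (T α β : ℝ) (u : SpaceTime n → ℝ)
    (z : SpaceTime n) : ℝ :=
  sSup {s : ℝ | (z.1, s) ∈ determinedSet U T α β u ∧ s ≤ z.2}

open scoped Classical in
/-- The hysteresis operator `h[u]`, with initial state `h₀`. -/
def hyst (U : Set (EuclideanSpace ℝ (Fin n))) (T α β : ℝ) (h₀ : EuclideanSpace ℝ (Fin n) → ℝ)
    (u : SpaceTime n → ℝ) (z : SpaceTime n) : ℝ :=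
  if z ∈ determinedSet U T α β u then determinedValue α β u h₀ z
  else determinedValue α β u h₀ (z.1, lastTime U T α β u z)

/-- `u` is a strong solution of `H[u] = h[u]` in `Q = U × ]0, T]` with the initial state `h₀` of the
relay: `u` is continuous on the closure of `Q`, `h₀` is a selection of `f(u(·, 0))`,
`u ∈ W^{2,1}_q(Q)` with `q > n + 2`, and the equation holds almost everywhere in `Q`. -/
structure IsStrongSolution (U : Set (EuclideanSpace ℝ (Fin n))) (T α β : ℝ) (q : ℝ≥0∞)
    (h₀ : EuclideanSpace ℝ (Fin n) → ℝ) (u : SpaceTime n → ℝ)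
    (Du : Fin n → SpaceTime n → ℝ) (D2u : Fin n → Fin n → SpaceTime n → ℝ)
    (ut : SpaceTime n → ℝ) : Prop where
  continuousOn : ContinuousOn u (closure (cylinder U T))
  initial : ∀ x ∈ U, h₀ x ∈ relay α β (u (x, 0))
  exponent : (n : ℝ≥0∞) + 2 < q
  sobolev : MemW21 (cylinder U T) q u Du D2u ut
  equation : ∀ᵐ z ∂(volume.restrict (cylinder U T)),
    (∑ i : Fin n, D2u i i z) - ut z = hyst U T α β h₀ u z

/-! ### The free boundary -/

/-- The region of `Q` where `h[u]` takes the value `y`; `y = 1` gives `Ω₊` and `y = -1` gives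
`Ω₋`. -/
def phase (U : Set (EuclideanSpace ℝ (Fin n))) (T α β : ℝ) (h₀ : EuclideanSpace ℝ (Fin n) → ℝ)
    (u : SpaceTime n → ℝ) (y : ℝ) : Set (SpaceTime n) :=
  {z | z ∈ cylinder U T ∧ hyst U T α β h₀ u z = y}

/-- The free boundary `Γ(u) = ∂Ω₊ ∩ ∂Ω₋`. -/
def freeBoundary (U : Set (EuclideanSpace ℝ (Fin n))) (T α β : ℝ)
    (h₀ : EuclideanSpace ℝ (Fin n) → ℝ) (u : SpaceTime n → ℝ) : Set (SpaceTime n) :=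
  frontier (phase U T α β h₀ u 1) ∩ frontier (phase U T α β h₀ u (-1))

/-- The vertical part `Γ_v` of the free boundary: the points of `Γ(u)` lying on a nondegenerate
segment parallel to the `t`-axis whose (relative) interior is contained in `Γ(u)` and avoids the
threshold levels `{u = α}` and `{u = β}`. The end points of such segments, at which the vertical
part is attached to `{u = α}` or `{u = β}`, belong to `Γ_v`. -/
def verticalPart (U : Set (EuclideanSpace ℝ (Fin n))) (T α β : ℝ)
    (h₀ : EuclideanSpace ℝ (Fin n) → ℝ) (u : SpaceTime n → ℝ) : Set (SpaceTime n) :=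
  {z | z ∈ freeBoundary U T α β h₀ u ∧ ∃ a b : ℝ, a < b ∧ z.2 ∈ Icc a b ∧
    ∀ s ∈ Ioo a b, (z.1, s) ∈ freeBoundary U T α β h₀ u ∧ α < u (z.1, s) ∧ u (z.1, s) < β}

/-- The derivative `D_e u = ∑ᵢ eᵢ Dᵢu` along the spatial direction `e`. -/
def spatialDeriv (Du : Fin n → SpaceTime n → ℝ) (e : EuclideanSpace ℝ (Fin n))
    (z : SpaceTime n) : ℝ :=
  ∑ i : Fin n, e i * Du i z

end Hysteresis

end

/-!
Formally `H[D_e u] = D_e h[u]`, so `(D_e u)₊` is sub-caloric as soon as `h[u]` is nondecreasing in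
the direction `e` wherever `D_e u > 0`. Off `Γ_v` this holds for the following reason. In the
interior of `Q`, the phases near a point of `{α < u < β}` are products with a time interval, so every
free boundary point of `{α < u < β}` is vertical (`mem_verticalPart_of_mem_freeBoundary`), and
`h[u]` is locally constant on the part of `{α < u < β}` in the interior of `Q \ Γ_v`. Hence `h[u]` can
decrease over a segment avoiding `Γ_v` only if `u` leaves, somewhere on the segment, the interval
between its values at the end points (`hyst_le_hyst_of_forall_mem_Icc`).

The proof works with difference quotients `w_δ(z) = (u(z + δe) - u(z)) / δ` and needs no continuity
of the gradient. Let `p` be a smooth convex approximation of the positive part whose slope vanishes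
on `(-∞, ε]`. Kato's inequality, obtained by mollifying `u`, gives
`H[p(w_δ)] ≥ p'(w_δ) (h(z + δe) - h(z)) / δ` (`integral_diffQuot_le`). The right-hand side is negative
only at points where `w_δ > ε` and `h` decreases over `[z, z + δe]`. There `u` has slopes above `ε`
and below `0` on the segment, which forces `ε² ≤ δ ∫₀^δ |D_{ee} u(z + se)|² ds`. As `D_{ee} u` is locally
square integrable, the set of these points has measure `O(δ²)`, so the contribution of the right-hand
side, which is at least `-2/δ`, tends to `0` with `δ`. The same energy bounds `|w_δ - D_e u|²`, so
`w_δ → D_e u` locally in `L¹` (`exists_oscillation_bound`). Letting `δ → 0` and then `ε → 0` proves the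
claim for `(D_e u)₊` (`integral_posPart_mul_adjointHeat_nonneg`), and `(D_e u)₋ = (D_{-e} u)₊`.
-/

open MeasureTheory Set Filter Topology Metric
open scoped ContDiff ENNReal

noncomputable section

namespace Hysteresis

section Relay

variable {n : ℕ} {U : Set (EuclideanSpace ℝ (Fin n))} {T α β : ℝ}
  {h₀ : EuclideanSpace ℝ (Fin n) → ℝ} {u : SpaceTime n → ℝ}

/-! ### The hysteresis operator away from the vertical part -/

lemma determinedValue_eq_or (hinit : ∀ x ∈ U, h₀ x ∈ relay α β (u (x, 0))) {z : SpaceTime n}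
    (hz : z ∈ determinedSet U T α β u) :
    determinedValue α β u h₀ z = 1 ∨ determinedValue α β u h₀ z = -1 := by
  unfold determinedValue
  split_ifs with h1 h2
  · exact Or.inr rfl
  · exact Or.inl rfl
  · rcases hz with (hz | hz) | hz
    · exact absurd hz.2 h1
    · exact absurd hz.2 h2
    · obtain ⟨x, t⟩ := z
      obtain ⟨hx, ht⟩ := hz
      obtain rfl : t = 0 := ht
      rcases hinit x hx with h | h | h
      · exact absurd h.1 h1
      · exact absurd h.1 h2
      · exact h.2.2.symm

/-- For `u` continuous the supremum in the definition of `lastTime` is attained. -/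
lemma lastTime_mem (hu : ContinuousOn u (closure (cylinder U T))) {x : EuclideanSpace ℝ (Fin n)}
    {t : ℝ} (hz : (x, t) ∈ cylinder U T) :
    (x, lastTime U T α β u (x, t)) ∈ determinedSet U T α β u := by
  obtain ⟨hx, ht0, htT⟩ := hz
  have hx : x ∈ U := hx
  replace ht0 : 0 < t := ht0
  replace htT : t ≤ T := htT
  have hT : 0 < T := ht0.trans_le htT
  set S : Set ℝ := {s | (x, s) ∈ determinedSet U T α β u ∧ s ≤ t} with hS
  have hcont : ContinuousOn (fun s => u (x, s)) (Icc 0 t) := by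
    refine hu.comp (by fun_prop) fun s hs => ?_
    have : (x, s) ∈ closure U ×ˢ closure (Ioc 0 T) :=
      ⟨subset_closure hx, by rw [closure_Ioc hT.ne]; exact ⟨hs.1, hs.2.trans htT⟩⟩
    rwa [cylinder, closure_prod_eq]
  have hSeq : S = (Icc 0 t ∩ (fun s => u (x, s)) ⁻¹' (Iic α ∪ Ici β)) ∪ {0} := by
    ext s
    simp only [hS, determinedSet, cylinder, mem_ofPred_eq, mem_union, mem_prod, mem_Ioc,
      mem_singleton_iff, mem_inter_iff, mem_Icc, mem_preimage, mem_Iic, mem_Ici]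
    constructor
    · rintro ⟨(⟨⟨_, h1, _⟩, h3⟩ | ⟨⟨_, h1, _⟩, h3⟩) | ⟨_, h1⟩, h4⟩
      · exact Or.inl ⟨⟨h1.le, h4⟩, Or.inl h3⟩
      · exact Or.inl ⟨⟨h1.le, h4⟩, Or.inr h3⟩
      · exact Or.inr h1
    · rintro (⟨⟨h1, h2⟩, h3⟩ | rfl)
      · rcases h1.eq_or_lt with rfl | h1
        · exact ⟨Or.inr ⟨hx, rfl⟩, h2⟩
        · rcases h3 with h3 | h3
          · exact ⟨Or.inl (Or.inl ⟨⟨hx, h1, h2.trans htT⟩, h3⟩), h2⟩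
          · exact ⟨Or.inl (Or.inr ⟨⟨hx, h1, h2.trans htT⟩, h3⟩), h2⟩
      · exact ⟨Or.inr ⟨hx, rfl⟩, ht0.le⟩
  have hclosed : IsClosed S := by
    rw [hSeq]
    exact (hcont.preimage_isClosed_of_isClosed isClosed_Icc
      (isClosed_Iic.union isClosed_Ici)).union isClosed_singleton
  exact (hclosed.csSup_mem ⟨0, Or.inr ⟨hx, rfl⟩, ht0.le⟩ ⟨t, fun s hs => hs.2⟩).1

lemma hyst_eq_or (hu : ContinuousOn u (closure (cylinder U T)))
    (hinit : ∀ x ∈ U, h₀ x ∈ relay α β (u (x, 0))) {z : SpaceTime n} (hz : z ∈ cylinder U T) :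
    hyst U T α β h₀ u z = 1 ∨ hyst U T α β h₀ u z = -1 := by
  unfold hyst
  split_ifs with h
  · exact determinedValue_eq_or hinit h
  · exact determinedValue_eq_or hinit (lastTime_mem hu hz)

lemma hyst_of_le {z : SpaceTime n} (hz : z ∈ cylinder U T) (h : u z ≤ α) :
    hyst U T α β h₀ u z = -1 := by
  rw [hyst, if_pos (show z ∈ determinedSet U T α β u from Or.inl (Or.inl ⟨hz, h⟩)),
    determinedValue, if_pos h]

lemma hyst_of_ge (hαβ : α < β) {z : SpaceTime n} (hz : z ∈ cylinder U T) (h : β ≤ u z) :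
    hyst U T α β h₀ u z = 1 := by
  rw [hyst, if_pos (show z ∈ determinedSet U T α β u from Or.inl (Or.inr ⟨hz, h⟩)),
    determinedValue, if_neg (by linarith), if_pos h]

/-- Between the thresholds the hysteresis operator keeps its value in time. -/
lemma hyst_eq_of_forall_mem_Ioo {x : EuclideanSpace ℝ (Fin n)} {a b : ℝ} (ha : 0 ≤ a)
    (hu : ∀ s ∈ Ioo a b, α < u (x, s) ∧ u (x, s) < β) {s t : ℝ} (hs : s ∈ Ioo a b)
    (ht : t ∈ Ioo a b) : hyst U T α β h₀ u (x, s) = hyst U T α β h₀ u (x, t) := by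
  have key : ∀ r ∈ Ioo a b, (x, r) ∉ determinedSet U T α β u := by
    rintro r hr ((h | h) | h)
    · exact (hu r hr).1.not_ge h.2
    · exact (hu r hr).2.not_ge h.2
    · exact (ha.trans_lt hr.1).ne' h.2
  have hset : {r : ℝ | (x, r) ∈ determinedSet U T α β u ∧ r ≤ s} =
      {r : ℝ | (x, r) ∈ determinedSet U T α β u ∧ r ≤ t} := by
    ext r
    refine and_congr_right fun hr => ?_
    have hab : r ≤ a ∨ b ≤ r := by
      by_contra! h
      exact key r h hr
    rcases hab with h | h
    · exact ⟨fun _ => h.trans ht.1.le, fun _ => h.trans hs.1.le⟩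
    · exact ⟨fun h' => absurd (h.trans h') hs.2.not_ge, fun h' => absurd (h.trans h') ht.2.not_ge⟩
  rw [hyst, hyst, if_neg (key s hs), if_neg (key t ht), lastTime, lastTime]
  simp only [hset]

/-- Inside `Q`, the free boundary is vertical at every point strictly between the thresholds: near
such a point both phases are products with a time interval. -/
lemma mem_verticalPart_of_mem_freeBoundary (hu : ContinuousOn u (closure (cylinder U T)))
    {z : SpaceTime n} (hzQ : z ∈ interior (cylinder U T)) (hzΓ : z ∈ freeBoundary U T α β h₀ u)
    (hα : α < u z) (hβ : u z < β) : z ∈ verticalPart U T α β h₀ u := by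
  have hcont : ContinuousAt u z :=
    hu.continuousAt (mem_of_superset (isOpen_interior.mem_nhds hzQ)
      (interior_subset.trans subset_closure))
  have hev : ∀ᶠ w in 𝓝 z, w ∈ cylinder U T ∧ α < u w ∧ u w < β := by
    filter_upwards [isOpen_interior.mem_nhds hzQ, hcont.eventually (lt_mem_nhds hα),
      hcont.eventually (gt_mem_nhds hβ)] with w h1 h2 h3 using ⟨interior_subset h1, h2, h3⟩
  obtain ⟨x, t⟩ := z
  rw [nhds_prod_eq] at hev
  obtain ⟨pa, hpa, pb, hpb, hp⟩ := eventually_prod_iff.1 hev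
  obtain ⟨a, b, htab, hab⟩ := mem_nhds_iff_exists_Ioo_subset.1 hpb
  have ha : 0 ≤ a := by
    by_contra! h
    obtain ⟨s, hs1, hs2⟩ := exists_between (lt_min h htab.1)
    have := (hp hpa.self_of_nhds (hab ⟨hs1, (hs2.trans_le (min_le_right _ _)).trans htab.2⟩)).1.2.1
    exact absurd this (not_lt.2 (hs2.trans_le (min_le_left _ _)).le)
  have hconst : ∀ y, pa y → ∀ s ∈ Ioo a b,
      hyst U T α β h₀ u (y, s) = hyst U T α β h₀ u (y, t) := fun y hy s hs =>
    hyst_eq_of_forall_mem_Ioo ha (fun r hr => (hp hy (hab hr)).2) hs htab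
  have hcl : ∀ c : ℝ, (x, t) ∈ closure (phase U T α β h₀ u c) → ∀ s ∈ Ioo a b,
      (x, s) ∈ closure (phase U T α β h₀ u c) := by
    intro c hc s hs
    set f : SpaceTime n → SpaceTime n := fun w => (w.1, s)
    have hf : MapsTo f ({w | pa w.1 ∧ w.2 ∈ Ioo a b} ∩ phase U T α β h₀ u c)
        (phase U T α β h₀ u c) := by
      rintro ⟨y, r⟩ ⟨⟨hy, hr⟩, hy1, hy2⟩
      refine ⟨(hp hy (hab hs)).1, ?_⟩
      rw [← hy2, hconst y hy s hs, hconst y hy r hr]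
    have hmem : (x, t) ∈ closure ({w | pa w.1 ∧ w.2 ∈ Ioo a b} ∩ phase U T α β h₀ u c) := by
      have hN : {w : SpaceTime n | pa w.1 ∧ w.2 ∈ Ioo a b} ∈ 𝓝 (x, t) :=
        prod_mem_nhds hpa (Ioo_mem_nhds htab.1 htab.2)
      rw [mem_closure_iff_nhds] at hc ⊢
      intro V hV
      simpa only [inter_assoc] using hc _ (inter_mem hV hN)
    exact map_mem_closure (f := f) (by fun_prop) hmem hf
  have hfr : ∀ c d : ℝ, c ≠ d → ∀ w : SpaceTime n, w ∈ closure (phase U T α β h₀ u c) →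
      w ∈ closure (phase U T α β h₀ u d) → w ∈ frontier (phase U T α β h₀ u c) := by
    refine fun c d hcd w hc hd => ⟨hc, fun hi => ?_⟩
    obtain ⟨v, hv1, hv2⟩ := mem_closure_iff.1 hd _ isOpen_interior hi
    exact hcd ((interior_subset hv1).2.symm.trans hv2.2)
  refine ⟨hzΓ, a, b, htab.1.trans htab.2, ⟨htab.1.le, htab.2.le⟩, fun s hs => ⟨⟨?_, ?_⟩,
    (hp hpa.self_of_nhds (hab hs)).2⟩⟩
  · exact hfr 1 (-1) (by norm_num) _ (hcl 1 hzΓ.1.1 s hs) (hcl (-1) hzΓ.2.1 s hs)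
  · exact hfr (-1) 1 (by norm_num) _ (hcl (-1) hzΓ.2.1 s hs) (hcl 1 hzΓ.1.1 s hs)

/-- Between the thresholds, a point of discontinuity of `h[u]` in the interior of `Q` lies on the
free boundary, hence in `Γ_v`. -/
lemma eventually_hyst_eq (hu : ContinuousOn u (closure (cylinder U T)))
    (hinit : ∀ x ∈ U, h₀ x ∈ relay α β (u (x, 0))) {z : SpaceTime n}
    (hz : z ∈ interior (cylinder U T \ verticalPart U T α β h₀ u))
    (hα : α < u z) (hβ : u z < β) :
    ∀ᶠ w in 𝓝 z, hyst U T α β h₀ u w = hyst U T α β h₀ u z := by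
  have hzQ : z ∈ interior (cylinder U T) := interior_mono sdiff_subset hz
  have hQ : ∀ᶠ w in 𝓝 z, w ∈ cylinder U T :=
    mem_of_superset (isOpen_interior.mem_nhds hzQ) interior_subset
  have key : ∀ c d : ℝ, (∀ w ∈ cylinder U T, hyst U T α β h₀ u w = c ∨ hyst U T α β h₀ u w = d) →
      z ∉ frontier (phase U T α β h₀ u c) →
      ∀ᶠ w in 𝓝 z, hyst U T α β h₀ u w = hyst U T α β h₀ u z := by
    intro c d hcd hfr
    suffices ∃ y, ∀ᶠ w in 𝓝 z, hyst U T α β h₀ u w = y by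
      obtain ⟨y, hy⟩ := this
      filter_upwards [hy] with w hw using hw.trans hy.self_of_nhds.symm
    by_cases hc : z ∈ closure (phase U T α β h₀ u c)
    · have hi : z ∈ interior (phase U T α β h₀ u c) := by_contra fun h => hfr ⟨hc, h⟩
      exact ⟨c, by filter_upwards [isOpen_interior.mem_nhds hi] with w hw
        using (interior_subset hw).2⟩
    · refine ⟨d, ?_⟩
      filter_upwards [hQ, isClosed_closure.isOpen_compl.mem_nhds hc] with w hw hw'
      exact (hcd w hw).resolve_left fun h => hw' (subset_closure ⟨hw, h⟩)
  have hΓ : z ∉ freeBoundary U T α β h₀ u := fun h =>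
    (interior_subset hz).2 (mem_verticalPart_of_mem_freeBoundary hu hzQ h hα hβ)
  by_cases h1 : z ∈ frontier (phase U T α β h₀ u 1)
  · exact key (-1) 1 (fun w hw => (hyst_eq_or hu hinit hw).symm) fun h => hΓ ⟨h1, h⟩
  · exact key 1 (-1) (fun w hw => hyst_eq_or hu hinit hw) h1

/-- If `h[u]` decreases along a segment avoiding `Γ_v`, then `u` leaves the interval spanned by its
values at the endpoints: otherwise `α < u < β` on the whole segment, where `h[u]` is locally
constant. -/
lemma hyst_le_hyst_of_forall_mem_Icc (hαβ : α < β) (hu : ContinuousOn u (closure (cylinder U T)))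
    (hinit : ∀ x ∈ U, h₀ x ∈ relay α β (u (x, 0))) {z v : SpaceTime n}
    (hseg : ∀ s ∈ Icc (0 : ℝ) 1,
      z + s • v ∈ interior (cylinder U T \ verticalPart U T α β h₀ u))
    (hmono : ∀ s ∈ Icc (0 : ℝ) 1, u (z + s • v) ∈ Icc (u z) (u (z + v))) :
    hyst U T α β h₀ u z ≤ hyst U T α β h₀ u (z + v) := by
  have h0 : z ∈ cylinder U T := by
    simpa using (interior_subset (hseg 0 (by simp))).1
  have h1 : z + v ∈ cylinder U T := by
    simpa using (interior_subset (hseg 1 (by simp))).1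
  by_contra! hlt
  have hα : α < u z := by
    by_contra! h
    rw [hyst_of_le h0 h] at hlt
    rcases hyst_eq_or hu hinit h1 with h | h <;> rw [h] at hlt <;> norm_num at hlt
  have hβ : u (z + v) < β := by
    by_contra! h
    rw [hyst_of_ge hαβ h1 h] at hlt
    rcases hyst_eq_or hu hinit h0 with h | h <;> rw [h] at hlt <;> norm_num at hlt
  have hc : ContinuousOn (fun s : ℝ => hyst U T α β h₀ u (z + s • v)) (Icc 0 1) := by
    intro s hs
    have hev := eventually_hyst_eq hu hinit (hseg s hs) (hα.trans_le (hmono s hs).1)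
      ((hmono s hs).2.trans_lt hβ)
    have hat : ContinuousAt (hyst U T α β h₀ u) (z + s • v) :=
      continuousAt_const.congr (hev.mono fun _ h => h.symm)
    exact (ContinuousAt.comp (f := fun s : ℝ => z + s • v) hat (by fun_prop)).continuousWithinAt
  have := isPreconnected_Icc.constant_of_mapsTo (T := {1, -1}) ⟨inferInstance⟩ hc
    (fun s hs => hyst_eq_or hu hinit (interior_subset (hseg s hs)).1)
    (left_mem_Icc.2 zero_le_one) (right_mem_Icc.2 zero_le_one)
  simp only [zero_smul, add_zero, one_smul] at this
  exact hlt.ne' this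

end Relay

section Mollification

open scoped Convolution
open ContinuousLinearMap (lsmul)

/-! ### Mollification in space-time -/

instance isAddHaarMeasure_spaceTime {n : ℕ} :
    (volume : Measure (SpaceTime n)).IsAddHaarMeasure :=
  inferInstanceAs ((volume : Measure (EuclideanSpace ℝ (Fin n))).prod
    (volume : Measure ℝ)).IsAddHaarMeasure

/-- The mollification `φ * f` of `f` by the bump function `φ`, normalized to have integral `1`. -/
def mollify {n : ℕ} (φ : ContDiffBump (0 : SpaceTime n)) (f : SpaceTime n → ℝ) : SpaceTime n → ℝ :=
  φ.normed volume ⋆[lsmul ℝ ℝ, volume] f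

variable {n : ℕ} {φ : ContDiffBump (0 : SpaceTime n)} {f g : SpaceTime n → ℝ}

lemma mollify_apply (z : SpaceTime n) :
    mollify φ f z = ∫ t, φ.normed volume t * f (z - t) := rfl

/-- The form of `mollify_apply` in which derivatives fall on `φ`. -/
lemma mollify_apply' (z : SpaceTime n) :
    mollify φ f z = ∫ t, f t * φ.normed volume (z - t) := by
  rw [mollify, ← convolution_flip]
  simp [convolution_def, mul_comm]

lemma contDiff_mollify (hf : LocallyIntegrable f) : ContDiff ℝ ∞ (mollify φ f) :=
  φ.hasCompactSupport_normed.contDiff_convolution_left _ φ.contDiff_normed hf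

lemma integrable_mollify (hf : LocallyIntegrable f) (z : SpaceTime n) :
    Integrable fun t => φ.normed volume t * f (z - t) :=
  φ.hasCompactSupport_normed.convolutionExists_left (lsmul ℝ ℝ) φ.continuous_normed hf z

lemma mollify_sub (hf : LocallyIntegrable f) (hg : LocallyIntegrable g) (z : SpaceTime n) :
    mollify φ (fun w => f w - g w) z = mollify φ f z - mollify φ g z := by
  simp only [mollify_apply, mul_sub]
  exact integral_sub (integrable_mollify hf z) (integrable_mollify hg z)

lemma mollify_sum_mul {ι : Type*} (s : Finset ι) (c : ι → ℝ) {F : ι → SpaceTime n → ℝ}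
    (hF : ∀ i, LocallyIntegrable (F i)) (z : SpaceTime n) :
    mollify φ (fun w => ∑ i ∈ s, c i * F i w) z = ∑ i ∈ s, c i * mollify φ (F i) z := by
  simp only [mollify_apply, Finset.mul_sum, mul_left_comm _ (c _)]
  rw [integral_finsetSum _ fun i _ => (integrable_mollify (hF i) z).const_mul (c i)]
  simp only [integral_const_mul]

lemma abs_mollify_le {C : ℝ} (hf : ∀ᵐ z, |f z| ≤ C) (z : SpaceTime n) :
    |mollify φ f z| ≤ C := by
  have h : ∀ᵐ t, ‖φ.normed volume t * f (z - t)‖ ≤ φ.normed volume t * C := by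
    have := (quasiMeasurePreserving_sub_left (volume : Measure (SpaceTime n)) z).ae hf
    filter_upwards [this] with t ht
    rw [norm_mul, Real.norm_of_nonneg (φ.nonneg_normed t), Real.norm_eq_abs]
    exact mul_le_mul_of_nonneg_left ht (φ.nonneg_normed t)
  refine (norm_integral_le_of_norm_le (φ.integrable_normed.mul_const C) h).trans_eq ?_
  rw [integral_mul_const, φ.integral_normed, one_mul]

/-- Jensen's inequality for the square of a mollification. -/
lemma sq_mollify_le (hf : LocallyIntegrable f) (hf2 : LocallyIntegrable fun z => f z ^ 2)
    (z : SpaceTime n) : mollify φ f z ^ 2 ≤ mollify φ (fun w => f w ^ 2) z := by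
  set c := mollify φ f z with hc
  have h0 : 0 ≤ ∫ t, φ.normed volume t * (f (z - t) - c) ^ 2 :=
    integral_nonneg fun t => mul_nonneg (φ.nonneg_normed t) (sq_nonneg _)
  have h1 : ∫ t, φ.normed volume t * (f (z - t) - c) ^ 2 =
      (∫ t, φ.normed volume t * f (z - t) ^ 2) - 2 * c * (∫ t, φ.normed volume t * f (z - t)) +
        c ^ 2 * ∫ t, φ.normed volume t := by
    have i1 := integrable_mollify (φ := φ) hf2 z
    have i2 := (integrable_mollify (φ := φ) hf z).const_mul (2 * c)
    have i3 := (φ.integrable_normed (μ := volume)).const_mul (c ^ 2)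
    rw [← integral_const_mul, ← integral_const_mul, ← integral_sub i1 i2]
    refine Eq.trans ?_ (integral_add (i1.sub i2) i3)
    exact integral_congr_ae (Eventually.of_forall fun t => by ring)
  rw [h1, φ.integral_normed, ← mollify_apply, ← hc] at h0
  rw [mollify_apply]
  linarith

/-- Mollification does not increase the `L²` norm. -/
lemma lintegral_sq_mollify_le (hf : LocallyIntegrable f) (hf2 : Integrable fun z => f z ^ 2) :
    ∫⁻ z, ENNReal.ofReal (mollify φ f z ^ 2) ≤ ENNReal.ofReal (∫ z, f z ^ 2) := by
  have hint : Integrable (mollify φ fun w => f w ^ 2) :=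
    φ.integrable_normed.integrable_convolution (lsmul ℝ ℝ) hf2
  calc ∫⁻ z, ENNReal.ofReal (mollify φ f z ^ 2)
      ≤ ∫⁻ z, ENNReal.ofReal (mollify φ (fun w => f w ^ 2) z) :=
        lintegral_mono fun z =>
          ENNReal.ofReal_le_ofReal (sq_mollify_le hf hf2.locallyIntegrable z)
    _ = ENNReal.ofReal (∫ z, mollify φ (fun w => f w ^ 2) z) := by
        refine (ofReal_integral_eq_lintegral_ofReal hint (Eventually.of_forall fun z => ?_)).symm
        exact integral_nonneg fun t => mul_nonneg (φ.nonneg_normed t) (sq_nonneg _)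
    _ = ENNReal.ofReal (∫ z, f z ^ 2) := by
        unfold mollify
        rw [integral_convolution (lsmul ℝ ℝ) φ.integrable_normed hf2, φ.integral_normed]
        simp

/-- At points whose `φ.rOut`-ball lies in `W`, mollification commutes with weak derivatives. -/
lemma dirDeriv_mollify {D W : Set (SpaceTime n)} {v : SpaceTime n} (h : HasWeakDeriv D f v g)
    (hWD : W ⊆ interior D) (hf : LocallyIntegrable (W.indicator f))
    {z : SpaceTime n} (hz : closedBall z φ.rOut ⊆ W) :
    dirDeriv v (mollify φ (W.indicator f)) z = mollify φ (W.indicator g) z := by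
  set ψ : SpaceTime n → ℝ := φ.normed volume
  have hψ : ContDiff ℝ ∞ ψ := φ.contDiff_normed
  set η : SpaceTime n → ℝ := fun t => ψ (z - t) with hη
  have hsupp : tsupport η ⊆ closedBall z φ.rOut := by
    refine closure_minimal (fun t ht => ?_) isClosed_closedBall
    have : z - t ∈ ball (0 : SpaceTime n) φ.rOut := φ.support_normed_eq (μ := volume) ▸ ht
    rw [mem_ball_zero_iff] at this
    rw [mem_closedBall, dist_comm, dist_eq_norm]
    exact this.le
  have htest : IsTestFunction D η :=
    ⟨hψ.comp (by fun_prop), HasCompactSupport.of_support_subset_isCompact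
      (isCompact_closedBall z φ.rOut) ((subset_tsupport _).trans hsupp),
      hsupp.trans (hz.trans hWD)⟩
  have hηd : ∀ t, dirDeriv v η t = -fderiv ℝ ψ (z - t) v := by
    intro t
    have h1 : HasFDerivAt ψ (fderiv ℝ ψ (z - t)) (z - t) :=
      (hψ.differentiable (by simp) _).hasFDerivAt
    have h2 : HasFDerivAt (fun t : SpaceTime n => z - t)
        (-ContinuousLinearMap.id ℝ (SpaceTime n)) t := (hasFDerivAt_id t).const_sub z
    rw [dirDeriv, show fderiv ℝ η t = _ from (h1.comp t h2).fderiv]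
    simp
  have hout : ∀ t ∉ W, η t = 0 ∧ dirDeriv v η t = 0 := by
    intro t ht
    have ht' : t ∉ tsupport η := fun h => ht (hz (hsupp h))
    refine ⟨image_eq_zero_of_notMem_tsupport ht', ?_⟩
    rw [dirDeriv, fderiv_of_notMem_tsupport ℝ ht']
    rfl
  have hD := HasCompactSupport.hasFDerivAt_convolution_right ((lsmul ℝ ℝ).flip)
    φ.hasCompactSupport_normed (μ := volume) hf (hψ.of_le (by simp)) z
  rw [convolution_flip] at hD
  rw [dirDeriv, mollify, hD.fderiv, convolution_precompR_apply _ hf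
    (φ.hasCompactSupport_normed.fderiv ℝ) (hψ.continuous_fderiv (by simp)),
    mollify_apply', convolution_def]
  have e1 : ∫ t, (((lsmul ℝ ℝ).flip) (W.indicator f t)) (fderiv ℝ ψ (z - t) v) =
      -∫ t, f t * dirDeriv v η t := by
    rw [← integral_neg]
    refine integral_congr_ae (Eventually.of_forall fun t => ?_)
    by_cases ht : t ∈ W
    · simp [hηd, ht, mul_comm]
    · simp [ht, (hout t ht).2]
  have e2 : ∫ t, W.indicator g t * ψ (z - t) = ∫ t, g t * η t := by
    refine integral_congr_ae (Eventually.of_forall fun t => ?_)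
    by_cases ht : t ∈ W
    · simp [hη, ht]
    · simp [ht, (hout t ht).1]
  rw [e1, e2, h.2.2 η htest, neg_neg]

/-- A sequence of bump functions whose supports shrink to the origin. The outer radius is twice the
inner one, as a bounded ratio is needed for almost everywhere convergence of mollifications. -/
def bumpSeq (n : ℕ) {ρ : ℝ} (hρ : 0 < ρ) (k : ℕ) : ContDiffBump (0 : SpaceTime n) where
  rIn := ρ / (k + 2) / 2
  rOut := ρ / (k + 2)
  rIn_pos := by positivity
  rIn_lt_rOut := half_lt_self (by positivity)

lemma bumpSeq_rOut_le {ρ : ℝ} (hρ : 0 < ρ) (k : ℕ) : (bumpSeq n hρ k).rOut ≤ ρ :=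
  div_le_self hρ.le (by linarith [(Nat.cast_nonneg k : (0 : ℝ) ≤ k)])

lemma tendsto_bumpSeq_rOut {ρ : ℝ} (hρ : 0 < ρ) :
    Tendsto (fun k => (bumpSeq n hρ k).rOut) atTop (𝓝 0) :=
  tendsto_const_nhds.div_atTop (tendsto_atTop_add_const_right _ _ tendsto_natCast_atTop_atTop)

lemma ae_tendsto_mollify {ρ : ℝ} (hρ : 0 < ρ) (hf : LocallyIntegrable f) :
    ∀ᵐ z, Tendsto (fun k => mollify (bumpSeq n hρ k) f z) atTop (𝓝 (f z)) := by
  refine ContDiffBump.ae_convolution_tendsto_right_of_locallyIntegrable (K := 2)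
    (tendsto_bumpSeq_rOut hρ) (Eventually.of_forall fun k => ?_) hf
  simp only [bumpSeq]
  linarith

lemma tendsto_mollify_of_continuousAt {ρ : ℝ} (hρ : 0 < ρ) (hf : LocallyIntegrable f)
    {z : SpaceTime n} (hz : ContinuousAt f z) :
    Tendsto (fun k => mollify (bumpSeq n hρ k) f z) atTop (𝓝 (f z)) :=
  ContDiffBump.convolution_tendsto_right (g := fun _ => f) (k := fun _ => z)
    (tendsto_bumpSeq_rOut hρ) (Eventually.of_forall fun _ => hf.aestronglyMeasurable)
    (hz.tendsto.comp tendsto_snd) tendsto_const_nhds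

end Mollification

section Kato

variable {n : ℕ}

/-! ### Convex approximation of the positive part -/

/-- `p` is a convex `C²` approximation of `s ↦ max s 0` with error at most `2ε`, nondecreasing with
slope at most `1` and vanishing slope on `(-∞, ε]`; `p'` and `p''` are its derivatives. -/
structure IsPosPartApprox (ε : ℝ) (p p' p'' : ℝ → ℝ) : Prop where
  hasDerivAt : ∀ s, HasDerivAt p (p' s) s
  hasDerivAt' : ∀ s, HasDerivAt p' (p'' s) s
  continuous'' : Continuous p''
  nonneg'' : ∀ s, 0 ≤ p'' s
  nonneg' : ∀ s, 0 ≤ p' s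
  le_one' : ∀ s, p' s ≤ 1
  eq_zero' : ∀ s ≤ ε, p' s = 0
  abs_sub_le : ∀ s, |p s - max s 0| ≤ 2 * ε

namespace IsPosPartApprox

variable {ε : ℝ} {p p' p'' : ℝ → ℝ}

lemma continuous (hp : IsPosPartApprox ε p p' p'') : Continuous p :=
  continuous_iff_continuousAt.2 fun s => (hp.hasDerivAt s).continuousAt

lemma continuous' (hp : IsPosPartApprox ε p p' p'') : Continuous p' :=
  continuous_iff_continuousAt.2 fun s => (hp.hasDerivAt' s).continuousAt

lemma abs_sub_le_abs_sub (hp : IsPosPartApprox ε p p' p'') (s t : ℝ) :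
    |p s - p t| ≤ |s - t| := by
  have := Convex.norm_image_sub_le_of_norm_hasDerivWithin_le (f := p) (f' := p') (C := 1)
    (s := univ) (fun x _ => (hp.hasDerivAt x).hasDerivWithinAt)
    (fun x _ => by rw [Real.norm_of_nonneg (hp.nonneg' x)]; exact hp.le_one' x)
    convex_univ (mem_univ t) (mem_univ s)
  simpa [Real.norm_eq_abs] using this

end IsPosPartApprox

lemma exists_isPosPartApprox {ε : ℝ} (hε : 0 < ε) : ∃ p p' p'', IsPosPartApprox ε p p' p'' := by
  set p' : ℝ → ℝ := fun s => Real.smoothTransition ((s - ε) / ε) with hp'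
  have hsm : ContDiff ℝ ∞ p' := Real.smoothTransition.contDiff.comp (by fun_prop)
  have hc : Continuous p' := hsm.continuous
  have h0 : ∀ s, 0 ≤ p' s := fun s => Real.smoothTransition.nonneg _
  have h1 : ∀ s, p' s ≤ 1 := fun s => Real.smoothTransition.le_one _
  have hz : ∀ s ≤ ε, p' s = 0 := fun s hs =>
    Real.smoothTransition.zero_of_nonpos (div_nonpos_of_nonpos_of_nonneg (by linarith) hε.le)
  have ho : ∀ s, 2 * ε ≤ s → p' s = 1 := fun s hs =>
    Real.smoothTransition.one_of_one_le ((one_le_div hε).2 (by linarith))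
  have hi : ∀ a b, IntervalIntegrable p' volume a b := fun a b => hc.intervalIntegrable a b
  refine ⟨fun s => ∫ r in (0 : ℝ)..s, p' r, p', deriv p', ?_, ?_, ?_, ?_, h0, h1, hz, ?_⟩
  · exact fun s => intervalIntegral.integral_hasDerivAt_right (hi _ _)
      hc.aestronglyMeasurable.stronglyMeasurableAtFilter hc.continuousAt
  · exact fun s => (hsm.differentiable (by simp) s).hasDerivAt
  · exact hsm.continuous_deriv (by simp)
  · refine fun s => Monotone.deriv_nonneg fun a b hab => Real.smoothTransition.monotone ?_
    gcongr
  · intro s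
    rcases le_total s 0 with hs | hs
    · have : ∫ r in (0 : ℝ)..s, p' r = 0 := by
        rw [intervalIntegral.integral_congr (g := fun _ => 0)]
        · simp
        · intro r hr
          rw [uIcc_of_ge hs] at hr
          exact hz r (hr.2.trans hε.le)
      simp only [this, max_eq_right hs]
      simpa using hε.le
    · have hup : ∫ r in (0 : ℝ)..s, p' r ≤ s := by
        calc ∫ r in (0 : ℝ)..s, p' r ≤ ∫ r in (0 : ℝ)..s, (1 : ℝ) :=
              intervalIntegral.integral_mono_on hs (hi _ _) (by simp) fun r _ => h1 r
          _ = s := by simp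
      have hlo : s - 2 * ε ≤ ∫ r in (0 : ℝ)..s, p' r := by
        rcases le_total s (2 * ε) with h | h
        · have := intervalIntegral.integral_nonneg (μ := volume) hs fun r _ => h0 r
          linarith
        · rw [← intervalIntegral.integral_add_adjacent_intervals (hi 0 (2 * ε)) (hi _ _)]
          have e1 := intervalIntegral.integral_nonneg (μ := volume)
            (show (0 : ℝ) ≤ 2 * ε by positivity) fun r _ => h0 r
          have e2 : ∫ r in (2 * ε)..s, p' r = s - 2 * ε := by
            rw [intervalIntegral.integral_congr (g := fun _ => 1)]
            · simp
            · intro r hr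
              rw [uIcc_of_le h] at hr
              exact ho r hr.1
          linarith
      rw [max_eq_left hs, abs_le]
      constructor <;> linarith

/-! ### Kato's inequality for smooth functions -/

/-- The heat operator `Δv - ∂ₜv`. -/
def heat (v : SpaceTime n → ℝ) (z : SpaceTime n) : ℝ :=
  (∑ i : Fin n, dirDeriv (coordDir i) (dirDeriv (coordDir i) v) z) - dirDeriv timeDir v z

lemma contDiff_dirDeriv {v : SpaceTime n → ℝ} (hv : ContDiff ℝ ∞ v) (w : SpaceTime n) :
    ContDiff ℝ ∞ (dirDeriv w v) :=
  (hv.fderiv_right (by simp)).clm_apply contDiff_const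

lemma hasCompactSupport_dirDeriv {η : SpaceTime n → ℝ} (hη : HasCompactSupport η)
    (w : SpaceTime n) : HasCompactSupport (dirDeriv w η) :=
  hη.fderiv_apply ℝ w

lemma contDiff_adjointHeat {η : SpaceTime n → ℝ} (hη : ContDiff ℝ ∞ η) :
    ContDiff ℝ ∞ (adjointHeat η) :=
  (contDiff_dirDeriv hη _).add
    (ContDiff.sum fun _ _ => contDiff_dirDeriv (contDiff_dirDeriv hη _) _)

lemma tsupport_dirDeriv_subset (η : SpaceTime n → ℝ) (w : SpaceTime n) :
    tsupport (dirDeriv w η) ⊆ tsupport η :=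
  tsupport_fderiv_apply_subset ℝ w

lemma adjointHeat_of_notMem_tsupport {η : SpaceTime n → ℝ} {z : SpaceTime n}
    (hz : z ∉ tsupport η) : adjointHeat η z = 0 := by
  have h : ∀ (w : SpaceTime n) (f : SpaceTime n → ℝ), z ∉ tsupport f → dirDeriv w f z = 0 :=
    fun w f hf => image_eq_zero_of_notMem_tsupport fun h => hf (tsupport_dirDeriv_subset f w h)
  rw [adjointHeat, h _ _ hz, Finset.sum_eq_zero, add_zero]
  exact fun i _ => h _ _ fun h => hz (tsupport_dirDeriv_subset η _ h)

lemma hasCompactSupport_adjointHeat {η : SpaceTime n → ℝ} (hη : HasCompactSupport η) :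
    HasCompactSupport (adjointHeat η) :=
  HasCompactSupport.of_support_subset_isCompact hη fun _ hz =>
    by_contra fun h => hz (adjointHeat_of_notMem_tsupport h)

lemma integral_mul_dirDeriv {f η : SpaceTime n → ℝ} {w : SpaceTime n} (hf : Differentiable ℝ f)
    (hf' : Continuous (dirDeriv w f)) (hη : ContDiff ℝ ∞ η) (hηc : HasCompactSupport η) :
    ∫ z, f z * dirDeriv w η z = -∫ z, dirDeriv w f z * η z :=
  integral_mul_fderiv_eq_neg_fderiv_mul_of_integrable
    ((hf'.mul hη.continuous).integrable_of_hasCompactSupport hηc.mul_left)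
    ((hf.continuous.mul (contDiff_dirDeriv hη w).continuous).integrable_of_hasCompactSupport
      (hasCompactSupport_dirDeriv hηc w).mul_left)
    ((hf.continuous.mul hη.continuous).integrable_of_hasCompactSupport hηc.mul_left)
    (fun z _ => hf z) (fun z _ => hη.differentiable (by simp) z)

lemma hasFDerivAt_comp {p p' : ℝ → ℝ} (hp : ∀ s, HasDerivAt p (p' s) s) {v : SpaceTime n → ℝ}
    (hv : ContDiff ℝ ∞ v) (z : SpaceTime n) :
    HasFDerivAt (fun z => p (v z)) (p' (v z) • fderiv ℝ v z) z :=
  (hp (v z)).comp_hasFDerivAt z (hv.differentiable (by simp) z).hasFDerivAt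

lemma dirDeriv_comp {p p' : ℝ → ℝ} (hp : ∀ s, HasDerivAt p (p' s) s) {v : SpaceTime n → ℝ}
    (hv : ContDiff ℝ ∞ v) (w : SpaceTime n) :
    dirDeriv w (fun z => p (v z)) = fun z => p' (v z) * dirDeriv w v z := by
  ext z
  rw [dirDeriv, (hasFDerivAt_comp hp hv z).fderiv]
  rfl

/-- Integrating by parts twice, the convexity of `p` leaves a term `p''(v) (D_w v)²` of good
sign. -/
lemma integral_comp_mul_dirDeriv_dirDeriv_ge {ε : ℝ} {p p' p'' : ℝ → ℝ}
    (hp : IsPosPartApprox ε p p' p'') {v η : SpaceTime n → ℝ} (hv : ContDiff ℝ ∞ v)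
    (hη : ContDiff ℝ ∞ η) (hηc : HasCompactSupport η) (hη0 : ∀ z, 0 ≤ η z) (w : SpaceTime n) :
    ∫ z, p' (v z) * dirDeriv w (dirDeriv w v) z * η z ≤
      ∫ z, p (v z) * dirDeriv w (dirDeriv w η) z := by
  have hv1 := contDiff_dirDeriv hv w
  have hv2 := contDiff_dirDeriv hv1 w
  have hd1 : Differentiable ℝ fun z => p (v z) := fun z =>
    (hasFDerivAt_comp hp.hasDerivAt hv z).differentiableAt
  have hd2 : Differentiable ℝ fun z => p' (v z) := fun z =>
    (hasFDerivAt_comp hp.hasDerivAt' hv z).differentiableAt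
  have hd3 : Differentiable ℝ fun z => p' (v z) * dirDeriv w v z :=
    hd2.mul (hv1.differentiable (by simp))
  have hcd : Continuous fun z => p' (v z) * dirDeriv w v z := hd3.continuous
  have hD : dirDeriv w (fun z => p' (v z) * dirDeriv w v z) = fun z =>
      p' (v z) * dirDeriv w (dirDeriv w v) z + p'' (v z) * dirDeriv w v z ^ 2 := by
    ext z
    have h2 := hasFDerivAt_comp hp.hasDerivAt' hv z
    have h3 := (hv1.differentiable (by simp) z).hasFDerivAt
    rw [dirDeriv, show fderiv ℝ (fun z => p' (v z) * dirDeriv w v z) z = _ from (h2.mul h3).fderiv]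
    simp [dirDeriv]
    ring
  have hcD : Continuous fun z =>
      p' (v z) * dirDeriv w (dirDeriv w v) z + p'' (v z) * dirDeriv w v z ^ 2 :=
    (hd2.continuous.mul hv2.continuous).add
      ((hp.continuous''.comp hv.continuous).mul (hv1.continuous.pow 2))
  rw [integral_mul_dirDeriv hd1 (by rw [dirDeriv_comp hp.hasDerivAt hv]; exact hcd)
    (contDiff_dirDeriv hη w) (hasCompactSupport_dirDeriv hηc w), dirDeriv_comp hp.hasDerivAt hv,
    integral_mul_dirDeriv hd3 (by rw [hD]; exact hcD) hη hηc, neg_neg, hD]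
  refine integral_mono
    (((hd2.continuous.mul hv2.continuous).mul hη.continuous).integrable_of_hasCompactSupport
      hηc.mul_left)
    ((hcD.mul hη.continuous).integrable_of_hasCompactSupport hηc.mul_left) fun z => ?_
  exact mul_le_mul_of_nonneg_right
    (le_add_of_nonneg_right (mul_nonneg (hp.nonneg'' _) (sq_nonneg _))) (hη0 z)

lemma integral_comp_mul_heat_le {ε : ℝ} {p p' p'' : ℝ → ℝ}
    (hp : IsPosPartApprox ε p p' p'') {v η : SpaceTime n → ℝ} (hv : ContDiff ℝ ∞ v)
    (hη : ContDiff ℝ ∞ η) (hηc : HasCompactSupport η) (hη0 : ∀ z, 0 ≤ η z) :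
    ∫ z, p' (v z) * heat v z * η z ≤ ∫ z, p (v z) * adjointHeat η z := by
  have hd1 : Differentiable ℝ fun z => p (v z) := fun z =>
    (hasFDerivAt_comp hp.hasDerivAt hv z).differentiableAt
  have hc1 : Continuous fun z => p' (v z) := hp.continuous'.comp hv.continuous
  have ht := contDiff_dirDeriv hv timeDir
  have hct : Continuous fun z => p' (v z) * dirDeriv timeDir v z := hc1.mul ht.continuous
  have hηt := contDiff_dirDeriv hη timeDir
  have hlhs : ∫ z, p' (v z) * heat v z * η z =
      (∑ i : Fin n, ∫ z, p' (v z) * dirDeriv (coordDir i) (dirDeriv (coordDir i) v) z * η z) -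
        ∫ z, p' (v z) * dirDeriv timeDir v z * η z := by
    have hi : ∀ i ∈ Finset.univ, Integrable fun z =>
        p' (v z) * dirDeriv (coordDir i) (dirDeriv (coordDir i) v) z * η z := fun i _ =>
      ((hc1.mul (contDiff_dirDeriv (contDiff_dirDeriv hv _) _).continuous).mul
        hη.continuous).integrable_of_hasCompactSupport hηc.mul_left
    have ht : Integrable fun z => p' (v z) * dirDeriv timeDir v z * η z :=
      (hct.mul hη.continuous).integrable_of_hasCompactSupport hηc.mul_left
    rw [← integral_finsetSum _ hi, ← integral_sub (integrable_finsetSum _ hi) ht]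
    refine integral_congr_ae (Eventually.of_forall fun z => ?_)
    simp only [heat, mul_sub, sub_mul, Finset.mul_sum, Finset.sum_mul]
  have hrhs : ∫ z, p (v z) * adjointHeat η z = (∫ z, p (v z) * dirDeriv timeDir η z) +
      ∑ i : Fin n, ∫ z, p (v z) * dirDeriv (coordDir i) (dirDeriv (coordDir i) η) z := by
    have hi : ∀ i ∈ Finset.univ, Integrable fun z =>
        p (v z) * dirDeriv (coordDir i) (dirDeriv (coordDir i) η) z := fun i _ =>
      (hd1.continuous.mul
        (contDiff_dirDeriv (contDiff_dirDeriv hη _) _).continuous).integrable_of_hasCompactSupport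
        (hasCompactSupport_dirDeriv (hasCompactSupport_dirDeriv hηc _) _).mul_left
    have ht : Integrable fun z => p (v z) * dirDeriv timeDir η z :=
      (hd1.continuous.mul hηt.continuous).integrable_of_hasCompactSupport
        (hasCompactSupport_dirDeriv hηc _).mul_left
    rw [← integral_finsetSum _ hi, ← integral_add ht (integrable_finsetSum _ hi)]
    refine integral_congr_ae (Eventually.of_forall fun z => ?_)
    simp only [adjointHeat, mul_add, Finset.mul_sum]
  rw [hlhs, hrhs, integral_mul_dirDeriv hd1 (by rw [dirDeriv_comp hp.hasDerivAt hv]; exact hct)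
    hη hηc, dirDeriv_comp hp.hasDerivAt hv]
  have := Finset.sum_le_sum fun i (_ : i ∈ Finset.univ) =>
    integral_comp_mul_dirDeriv_dirDeriv_ge hp hv hη hηc hη0 (coordDir i)
  linarith

/-! ### Oscillation of the slope on an interval -/

lemma sq_intervalIntegral_le {f : ℝ → ℝ} (hf : Continuous f) {a b : ℝ} (hab : a ≤ b) :
    (∫ s in a..b, f s) ^ 2 ≤ (b - a) * ∫ s in a..b, f s ^ 2 := by
  rcases hab.eq_or_lt with rfl | hlt
  · simp
  set I := ∫ s in a..b, f s with hI
  have h0 : 0 ≤ ∫ s in a..b, ((b - a) * f s - I) ^ 2 :=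
    intervalIntegral.integral_nonneg hab fun s _ => sq_nonneg _
  have h1 : ∫ s in a..b, ((b - a) * f s - I) ^ 2 =
      (b - a) ^ 2 * (∫ s in a..b, f s ^ 2) - 2 * (b - a) * I * I + (b - a) * I ^ 2 := by
    have e : ∀ s, ((b - a) * f s - I) ^ 2 =
        (b - a) ^ 2 * f s ^ 2 - 2 * (b - a) * I * f s + I ^ 2 := fun s => by ring
    simp_rw [e]
    have i1 : IntervalIntegrable (fun s => (b - a) ^ 2 * f s ^ 2) volume a b :=
      Continuous.intervalIntegrable (by fun_prop) _ _
    have i2 : IntervalIntegrable (fun s => 2 * (b - a) * I * f s) volume a b :=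
      Continuous.intervalIntegrable (by fun_prop) _ _
    rw [intervalIntegral.integral_add (i1.sub i2) (by simp), intervalIntegral.integral_sub i1 i2,
      intervalIntegral.integral_const_mul, intervalIntegral.integral_const_mul, ← hI]
    simp
  rw [h1] at h0
  have hpos : 0 < b - a := sub_pos.2 hlt
  have : 0 ≤ (b - a) * ((b - a) * (∫ s in a..b, f s ^ 2) - I ^ 2) := by linarith
  linarith [nonneg_of_mul_nonneg_right this hpos]

section Slope

variable {f f' f'' : ℝ → ℝ} {δ : ℝ}

lemma sq_sub_le_of_hasDerivAt (hf' : ∀ s ∈ Icc 0 δ, HasDerivAt f' (f'' s) s)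
    (hc : Continuous f'') {a b : ℝ} (ha : a ∈ Icc 0 δ) (hb : b ∈ Icc 0 δ) :
    (f' b - f' a) ^ 2 ≤ δ * ∫ s in (0 : ℝ)..δ, f'' s ^ 2 := by
  wlog hab : a ≤ b generalizing a b
  · rw [← neg_sq, neg_sub]
    exact this hb ha (not_le.1 hab).le
  have hsub : uIcc a b ⊆ Icc 0 δ := by
    rw [uIcc_of_le hab]
    exact Icc_subset_Icc ha.1 hb.2
  rw [← intervalIntegral.integral_eq_sub_of_hasDerivAt (fun s hs => hf' s (hsub hs))
    (hc.intervalIntegrable _ _)]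
  refine (sq_intervalIntegral_le hc hab).trans ?_
  have hmono : ∫ s in a..b, f'' s ^ 2 ≤ ∫ s in (0 : ℝ)..δ, f'' s ^ 2 :=
    intervalIntegral.integral_mono_interval ha.1 hab hb.2
      (Eventually.of_forall fun s => sq_nonneg _) ((hc.pow 2).intervalIntegrable _ _)
  have hnn : 0 ≤ ∫ s in a..b, f'' s ^ 2 :=
    intervalIntegral.integral_nonneg hab fun s _ => sq_nonneg _
  exact mul_le_mul (by linarith [ha.1, hb.2]) hmono hnn (ha.1.trans ha.2)

lemma sq_slope_sub_slope_le (hf : ∀ s ∈ Icc 0 δ, HasDerivAt f (f' s) s)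
    (hf' : ∀ s ∈ Icc 0 δ, HasDerivAt f' (f'' s) s) (hc : Continuous f'')
    {a b c d : ℝ} (ha : 0 ≤ a) (hab : a < b) (hb : b ≤ δ) (hc0 : 0 ≤ c)
    (hcd : c < d) (hd : d ≤ δ) :
    ((f b - f a) / (b - a) - (f d - f c) / (d - c)) ^ 2 ≤ δ * ∫ s in (0 : ℝ)..δ, f'' s ^ 2 := by
  have key : ∀ a b : ℝ, 0 ≤ a → a < b → b ≤ δ →
      ∃ s ∈ Icc 0 δ, f' s = (f b - f a) / (b - a) := by
    intro a b ha hab hb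
    have hsub : Icc a b ⊆ Icc 0 δ := Icc_subset_Icc ha hb
    obtain ⟨s, hs, h⟩ := exists_hasDerivAt_eq_slope f f' hab
      (fun s hs => (hf s (hsub hs)).continuousAt.continuousWithinAt)
      (fun s hs => hf s (hsub (Ioo_subset_Icc_self hs)))
    exact ⟨s, hsub (Ioo_subset_Icc_self hs), h⟩
  obtain ⟨s, hs, h1⟩ := key a b ha hab hb
  obtain ⟨t, ht, h2⟩ := key c d hc0 hcd hd
  rw [← h1, ← h2]
  exact sq_sub_le_of_hasDerivAt hf' hc ht hs

lemma sq_slope_sub_deriv_le (hf : ∀ s ∈ Icc 0 δ, HasDerivAt f (f' s) s)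
    (hf' : ∀ s ∈ Icc 0 δ, HasDerivAt f' (f'' s) s) (hc : Continuous f'')
    (hδ : 0 < δ) :
    ((f δ - f 0) / δ - f' 0) ^ 2 ≤ δ * ∫ s in (0 : ℝ)..δ, f'' s ^ 2 := by
  obtain ⟨s, hs, h⟩ := exists_hasDerivAt_eq_slope f f' hδ
    (fun s hs => (hf s hs).continuousAt.continuousWithinAt)
    (fun s hs => hf s (Ioo_subset_Icc_self hs))
  rw [sub_zero] at h
  rw [← h]
  exact sq_sub_le_of_hasDerivAt hf' hc (left_mem_Icc.2 hδ.le) (Ioo_subset_Icc_self hs)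

/-- A function that rises by more than `εδ` over `[0, δ]` but leaves the interval between its
end values has slopes both above `ε` and below `0`. -/
lemma sq_le_of_notMem_Icc (hf : ∀ s ∈ Icc 0 δ, HasDerivAt f (f' s) s)
    (hf' : ∀ s ∈ Icc 0 δ, HasDerivAt f' (f'' s) s) (hc : Continuous f'')
    {ε s : ℝ} (hε : 0 ≤ ε) (hs : s ∈ Icc 0 δ) (hrise : f 0 + ε * δ < f δ) (hout : f s < f 0 ∨ f δ < f s) :
    ε ^ 2 ≤ δ * ∫ s in (0 : ℝ)..δ, f'' s ^ 2 := by
  have hδ : 0 ≤ δ := hs.1.trans hs.2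
  have hεδ := mul_nonneg hε hδ
  have h0 : 0 < s := hs.1.lt_of_ne (by rintro rfl; rcases hout with h | h <;> linarith)
  have h1 : s < δ := hs.2.lt_of_ne (by rintro rfl; rcases hout with h | h <;> linarith)
  have h1' : 0 < δ - s := sub_pos.2 h1
  have hεs : ε * s ≤ ε * δ := mul_le_mul_of_nonneg_left h1.le hε
  have hεs' : ε * (δ - s) ≤ ε * δ := mul_le_mul_of_nonneg_left (by linarith) hε
  refine le_trans ?_ (sq_slope_sub_slope_le hf hf' hc h0.le h1 le_rfl le_rfl h0 h1.le)
  rw [sub_zero]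
  rcases hout with h | h
  · have e1 : ε ≤ (f δ - f s) / (δ - s) := (le_div_iff₀ h1').2 (by linarith)
    have e2 : (f s - f 0) / s ≤ 0 := div_nonpos_of_nonpos_of_nonneg (by linarith) h0.le
    exact pow_le_pow_left₀ hε (by linarith) 2
  · have e1 : (f δ - f s) / (δ - s) ≤ 0 := div_nonpos_of_nonpos_of_nonneg (by linarith) h1'.le
    have e2 : ε ≤ (f s - f 0) / s := (le_div_iff₀ h0).2 (by linarith)
    rw [← neg_sq ((f δ - f s) / (δ - s) - _)]
    exact pow_le_pow_left₀ hε (by linarith) 2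

end Slope

end Kato

section Approximants

variable {n : ℕ}

/-! ### Mollified solutions -/

lemma dirDeriv_congr {f g : SpaceTime n → ℝ} {z : SpaceTime n} (h : f =ᶠ[𝓝 z] g)
    (w : SpaceTime n) : dirDeriv w f z = dirDeriv w g z := by
  rw [dirDeriv, dirDeriv, h.fderiv_eq]

lemma spaceDir_eq_sum (e : EuclideanSpace ℝ (Fin n)) :
    spaceDir e = ∑ i, e i • coordDir i := by
  refine Prod.ext ?_ ?_
  · simp only [spaceDir, coordDir, Prod.fst_sum, Prod.smul_fst]
    ext j
    simp [Pi.single_apply]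
  · simp [spaceDir, coordDir, Prod.snd_sum]

lemma dirDeriv_spaceDir (e : EuclideanSpace ℝ (Fin n)) (f : SpaceTime n → ℝ) (z : SpaceTime n) :
    dirDeriv (spaceDir e) f z = ∑ i, e i * dirDeriv (coordDir i) f z := by
  simp [dirDeriv, spaceDir_eq_sum]

/-- The pure second derivative `D_{ee} u = ∑ᵢⱼ eᵢ eⱼ Dᵢⱼu`. -/
def spatialHess (D2u : Fin n → Fin n → SpaceTime n → ℝ) (e : EuclideanSpace ℝ (Fin n))
    (z : SpaceTime n) : ℝ :=
  ∑ i, e i * ∑ j, e j * D2u i j z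

lemma HasWeakDeriv.integrable_indicator_right {D W : Set (SpaceTime n)} {f g : SpaceTime n → ℝ}
    {v : SpaceTime n} (h : HasWeakDeriv D f v g) (hW : IsCompact W) (hWD : W ⊆ interior D) :
    Integrable (W.indicator g) :=
  (h.2.1.integrableOn_compact_subset hWD hW).integrable_indicator hW.measurableSet

section Approximation

variable {D W P : Set (SpaceTime n)} {φ : ContDiffBump (0 : SpaceTime n)} {u : SpaceTime n → ℝ}
  {Du : Fin n → SpaceTime n → ℝ} {D2u : Fin n → Fin n → SpaceTime n → ℝ} {ut : SpaceTime n → ℝ}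

lemma indicator_spatialDeriv (e : EuclideanSpace ℝ (Fin n)) :
    W.indicator (spatialDeriv Du e) = fun z => ∑ i, e i * W.indicator (Du i) z := by
  ext z
  by_cases hz : z ∈ W <;> simp [hz, spatialDeriv]

lemma indicator_spatialHess (e : EuclideanSpace ℝ (Fin n)) :
    W.indicator (spatialHess D2u e) =
      fun z => ∑ i, e i * ∑ j, e j * W.indicator (D2u i j) z := by
  ext z
  by_cases hz : z ∈ W <;> simp [hz, spatialHess]

lemma integrable_indicator_spatialDeriv (hgrad : ∀ i, HasWeakDeriv D u (coordDir i) (Du i))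
    (hW : IsCompact W) (hWD : W ⊆ interior D) (e : EuclideanSpace ℝ (Fin n)) :
    Integrable (W.indicator (spatialDeriv Du e)) := by
  rw [indicator_spatialDeriv]
  exact integrable_finsetSum _ fun i _ =>
    ((hgrad i).integrable_indicator_right hW hWD).const_mul _

lemma dirDeriv_mollify_spaceDir (hgrad : ∀ i, HasWeakDeriv D u (coordDir i) (Du i))
    (hW : IsCompact W) (hWD : W ⊆ interior D) (hu : Integrable (W.indicator u))
    (e : EuclideanSpace ℝ (Fin n)) {z : SpaceTime n} (hz : closedBall z φ.rOut ⊆ W) :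
    dirDeriv (spaceDir e) (mollify φ (W.indicator u)) z =
      mollify φ (W.indicator (spatialDeriv Du e)) z := by
  rw [dirDeriv_spaceDir, indicator_spatialDeriv, mollify_sum_mul _ _ fun i =>
    ((hgrad i).integrable_indicator_right hW hWD).locallyIntegrable]
  exact Finset.sum_congr rfl fun i _ => by
    rw [dirDeriv_mollify (hgrad i) hWD hu.locallyIntegrable hz]

lemma dirDeriv_dirDeriv_mollify (hgrad : ∀ i, HasWeakDeriv D u (coordDir i) (Du i))
    (hhess : ∀ i j, HasWeakDeriv D (Du i) (coordDir j) (D2u i j))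
    (hW : IsCompact W) (hWD : W ⊆ interior D) (hu : Integrable (W.indicator u))
    (hPo : IsOpen P) (hP : ∀ z ∈ P, closedBall z φ.rOut ⊆ W) {z : SpaceTime n} (hz : z ∈ P)
    (i j : Fin n) :
    dirDeriv (coordDir j) (dirDeriv (coordDir i) (mollify φ (W.indicator u))) z =
      mollify φ (W.indicator (D2u i j)) z := by
  have hev : dirDeriv (coordDir i) (mollify φ (W.indicator u)) =ᶠ[𝓝 z]
      mollify φ (W.indicator (Du i)) := by
    filter_upwards [hPo.mem_nhds hz] with y hy
    exact dirDeriv_mollify (hgrad i) hWD hu.locallyIntegrable (hP y hy)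
  rw [dirDeriv_congr hev, dirDeriv_mollify (hhess i j) hWD
    ((hgrad i).integrable_indicator_right hW hWD).locallyIntegrable (hP z hz)]

lemma dirDeriv_dirDeriv_mollify_spaceDir (hgrad : ∀ i, HasWeakDeriv D u (coordDir i) (Du i))
    (hhess : ∀ i j, HasWeakDeriv D (Du i) (coordDir j) (D2u i j))
    (hW : IsCompact W) (hWD : W ⊆ interior D) (hu : Integrable (W.indicator u))
    (hPo : IsOpen P) (hP : ∀ z ∈ P, closedBall z φ.rOut ⊆ W) {z : SpaceTime n} (hz : z ∈ P)
    (e : EuclideanSpace ℝ (Fin n)) :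
    dirDeriv (spaceDir e) (dirDeriv (spaceDir e) (mollify φ (W.indicator u))) z =
      mollify φ (W.indicator (spatialHess D2u e)) z := by
  set f := mollify φ (W.indicator u) with hf
  have hfs : ContDiff ℝ ∞ f := contDiff_mollify hu.locallyIntegrable
  have h1 : dirDeriv (spaceDir e) f = fun y => ∑ i, e i * dirDeriv (coordDir i) f y :=
    funext fun y => dirDeriv_spaceDir e f y
  have h2 : dirDeriv (spaceDir e) (fun y => ∑ i, e i * dirDeriv (coordDir i) f y) z =
      ∑ i, e i * dirDeriv (spaceDir e) (dirDeriv (coordDir i) f) z := by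
    have hd : HasFDerivAt (fun y => ∑ i, e i * dirDeriv (coordDir i) f y)
        (∑ i, e i • fderiv ℝ (dirDeriv (coordDir i) f) z) z :=
      HasFDerivAt.fun_sum fun i _ =>
        (((contDiff_dirDeriv hfs (coordDir i)).differentiable (by simp) z).hasFDerivAt.const_mul
          (e i))
    rw [dirDeriv, hd.fderiv]
    simp [dirDeriv]
  have hint : ∀ i j, LocallyIntegrable (W.indicator (D2u i j)) := fun i j =>
    ((hhess i j).integrable_indicator_right hW hWD).locallyIntegrable
  have hint' : ∀ i, LocallyIntegrable fun y => ∑ j, e j * W.indicator (D2u i j) y := fun i =>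
    (integrable_finsetSum _ fun j _ =>
      ((hhess i j).integrable_indicator_right hW hWD).const_mul _).locallyIntegrable
  rw [h1, h2, indicator_spatialHess, mollify_sum_mul _ _ hint']
  refine Finset.sum_congr rfl fun i _ => ?_
  rw [dirDeriv_spaceDir, mollify_sum_mul _ _ (hint i)]
  congr 1
  exact Finset.sum_congr rfl fun j _ => by
    rw [dirDeriv_dirDeriv_mollify hgrad hhess hW hWD hu hPo hP hz]

lemma heat_mollify (hgrad : ∀ i, HasWeakDeriv D u (coordDir i) (Du i))
    (hhess : ∀ i j, HasWeakDeriv D (Du i) (coordDir j) (D2u i j))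
    (htime : HasWeakDeriv D u timeDir ut)
    (hW : IsCompact W) (hWD : W ⊆ interior D) (hu : Integrable (W.indicator u))
    (hPo : IsOpen P) (hP : ∀ z ∈ P, closedBall z φ.rOut ⊆ W) {z : SpaceTime n} (hz : z ∈ P) :
    heat (mollify φ (W.indicator u)) z =
      mollify φ (W.indicator fun y => (∑ i, D2u i i y) - ut y) z := by
  have hind : (W.indicator fun y => (∑ i, D2u i i y) - ut y) =
      fun y => (∑ i, 1 * W.indicator (D2u i i) y) - W.indicator ut y := by
    ext y
    by_cases hy : y ∈ W <;> simp [hy]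
  have hint : ∀ i, Integrable (W.indicator (D2u i i)) := fun i =>
    (hhess i i).integrable_indicator_right hW hWD
  rw [hind, mollify_sub (integrable_finsetSum _ fun i _ =>
    (hint i).const_mul 1).locallyIntegrable
    (htime.integrable_indicator_right hW hWD).locallyIntegrable,
    mollify_sum_mul _ _ fun i => (hint i).locallyIntegrable, heat,
    dirDeriv_mollify htime hWD hu.locallyIntegrable (hP z hz)]
  congr 1
  exact Finset.sum_congr rfl fun i _ => by
    rw [dirDeriv_dirDeriv_mollify hgrad hhess hW hWD hu hPo hP hz, one_mul]

end Approximation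

/-! ### Oscillation of the directional derivative along short segments -/

/-- `δ ∫₀^δ f(z + s v)² ds`, the quantity controlling the squared oscillation over the segment
`[z, z + δ v]` of a function whose derivative along `v` is `f`. -/
def segmentEnergy (v : SpaceTime n) (δ : ℝ) (f : SpaceTime n → ℝ) (z : SpaceTime n) : ℝ≥0∞ :=
  ENNReal.ofReal δ * ∫⁻ s in Ioc 0 δ, ENNReal.ofReal (f (z + s • v) ^ 2)

lemma measurable_segmentEnergy {f : SpaceTime n → ℝ} (hf : Continuous f) (v : SpaceTime n)
    (δ : ℝ) : Measurable (segmentEnergy v δ f) := by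
  have : Measurable fun q : SpaceTime n × ℝ => ENNReal.ofReal (f (q.1 + q.2 • v) ^ 2) :=
    (Continuous.measurable (by fun_prop)).ennreal_ofReal
  exact (this.lintegral_prod_right' (ν := volume.restrict (Ioc 0 δ))).const_mul _

lemma lintegral_segmentEnergy {f : SpaceTime n → ℝ} (hf : Continuous f) (v : SpaceTime n)
    {δ : ℝ} : ∫⁻ z, segmentEnergy v δ f z =
      ENNReal.ofReal δ * (ENNReal.ofReal δ * ∫⁻ z, ENNReal.ofReal (f z ^ 2)) := by
  have hm : Measurable fun q : SpaceTime n × ℝ => ENNReal.ofReal (f (q.1 + q.2 • v) ^ 2) :=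
    (Continuous.measurable (by fun_prop)).ennreal_ofReal
  unfold segmentEnergy
  rw [lintegral_const_mul _ (hm.lintegral_prod_right' (ν := volume.restrict (Ioc 0 δ))),
    lintegral_lintegral_swap hm.aemeasurable]
  congr 1
  have : ∀ s : ℝ, ∫⁻ z, ENNReal.ofReal (f (z + s • v) ^ 2) = ∫⁻ z, ENNReal.ofReal (f z ^ 2) :=
    fun s => lintegral_add_right_eq_self (fun z => ENNReal.ofReal (f z ^ 2)) (s • v)
  simp only [this, lintegral_const, Measure.restrict_apply_univ, Real.volume_Ioc, sub_zero]
  rw [mul_comm]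

lemma ofReal_mul_intervalIntegral_eq {f : SpaceTime n → ℝ} (hf : Continuous f) (v : SpaceTime n)
    {δ : ℝ} (hδ : 0 ≤ δ) (z : SpaceTime n) :
    ENNReal.ofReal (δ * ∫ s in (0 : ℝ)..δ, f (z + s • v) ^ 2) = segmentEnergy v δ f z := by
  have hc : Continuous fun s : ℝ => f (z + s • v) ^ 2 := by fun_prop
  rw [segmentEnergy, ENNReal.ofReal_mul hδ, intervalIntegral.integral_of_le hδ,
    ofReal_integral_eq_lintegral_ofReal
      (hc.integrableOn_Icc.mono_set Ioc_subset_Icc_self) (Eventually.of_forall fun s => sq_nonneg _)]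

section Oscillation

variable {D W P : Set (SpaceTime n)} {u : SpaceTime n → ℝ}
  {Du : Fin n → SpaceTime n → ℝ} {D2u : Fin n → Fin n → SpaceTime n → ℝ}

/-- For a function with square integrable pure second derivative along `e`, a nonnegative function
of integral `O(δ²)` bounds, at almost every `z`, the squared distance of the difference quotient
over `[z, z + δe]` to the derivative at `z`, and the squared slope `ε²` of `u` over the segment
whenever `u` leaves the interval between its end values there. It is the lower limit of the energies
of the mollified functions, so Fatou's lemma bounds its integral. -/
lemma exists_oscillation_bound (hgrad : ∀ i, HasWeakDeriv D u (coordDir i) (Du i))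
    (hhess : ∀ i j, HasWeakDeriv D (Du i) (coordDir j) (D2u i j))
    (huc : ContinuousOn u (interior D)) (hW : IsCompact W) (hWD : W ⊆ interior D)
    (hPo : IsOpen P) {ρ : ℝ} (hρ : 0 < ρ) (hP : ∀ z ∈ P, closedBall z ρ ⊆ W)
    (e : EuclideanSpace ℝ (Fin n))
    (hL2 : Integrable fun z => W.indicator (spatialHess D2u e) z ^ 2) {δ : ℝ} (hδ : 0 < δ) :
    ∃ R : SpaceTime n → ℝ, Integrable R ∧ (∀ z, 0 ≤ R z) ∧
      ∫ z, R z ≤ δ ^ 2 * ∫ z, W.indicator (spatialHess D2u e) z ^ 2 ∧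
      ∀ᵐ z, (∀ s ∈ Icc 0 δ, z + s • spaceDir e ∈ P) →
        ((u (z + δ • spaceDir e) - u z) / δ - spatialDeriv Du e z) ^ 2 ≤ R z ∧
        ∀ ε s : ℝ, 0 ≤ ε → s ∈ Icc 0 δ → u z + ε * δ < u (z + δ • spaceDir e) →
          (u (z + s • spaceDir e) < u z ∨ u (z + δ • spaceDir e) < u (z + s • spaceDir e)) →
          ε ^ 2 ≤ R z := by
  set v := spaceDir e with hv
  have huW : Integrable (W.indicator u) :=
    ((huc.mono hWD).integrableOn_compact hW).integrable_indicator hW.measurableSet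
  have hw : Integrable (W.indicator (spatialHess D2u e)) := by
    rw [indicator_spatialHess]
    exact integrable_finsetSum _ fun i _ => (integrable_finsetSum _ fun j _ =>
      ((hhess i j).integrable_indicator_right hW hWD).const_mul _).const_mul _
  set M := ∫ z, W.indicator (spatialHess D2u e) z ^ 2 with hM
  have hM0 : 0 ≤ M := integral_nonneg fun z => sq_nonneg _
  set U : ℕ → SpaceTime n → ℝ := fun k => mollify (bumpSeq n hρ k) (W.indicator u) with hU
  set m : ℕ → SpaceTime n → ℝ :=
    fun k => mollify (bumpSeq n hρ k) (W.indicator (spatialHess D2u e)) with hm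
  have hUs : ∀ k, ContDiff ℝ ∞ (U k) := fun k => contDiff_mollify huW.locallyIntegrable
  have hmc : ∀ k, Continuous (m k) := fun k => (contDiff_mollify hw.locallyIntegrable).continuous
  have hPk : ∀ k, ∀ z ∈ P, closedBall z (bumpSeq n hρ k).rOut ⊆ W := fun k z hz =>
    (closedBall_subset_closedBall (bumpSeq_rOut_le hρ k)).trans (hP z hz)
  have hPW : P ⊆ W := fun z hz => hP z hz (mem_closedBall_self hρ.le)
  set F : SpaceTime n → ℝ≥0∞ := fun z => liminf (fun k => segmentEnergy v δ (m k) z) atTop with hF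
  have hFm : Measurable F := Measurable.liminf fun k => measurable_segmentEnergy (hmc k) v δ
  have hFint : ∫⁻ z, F z ≤ ENNReal.ofReal (δ ^ 2 * M) := by
    refine (lintegral_liminf_le fun k => measurable_segmentEnergy (hmc k) v δ).trans ?_
    refine liminf_le_of_le (by isBoundedDefault) fun b hb => ?_
    obtain ⟨k, hk⟩ := hb.exists
    refine hk.trans ?_
    rw [lintegral_segmentEnergy (hmc k), sq, mul_assoc, ENNReal.ofReal_mul hδ.le,
      ENNReal.ofReal_mul hδ.le]
    gcongr
    exact lintegral_sq_mollify_le hw.locallyIntegrable hL2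
  have hFtop : ∫⁻ z, F z ≠ ⊤ := (hFint.trans_lt ENNReal.ofReal_lt_top).ne
  have hFfin : ∀ᵐ z, F z < ⊤ := ae_lt_top hFm hFtop
  have hGc := ae_tendsto_mollify hρ
    (integrable_indicator_spatialDeriv hgrad hW hWD e).locallyIntegrable
  refine ⟨fun z => (F z).toReal, integrable_toReal_of_lintegral_ne_top hFm.aemeasurable hFtop,
    fun z => ENNReal.toReal_nonneg, ?_, ?_⟩
  · rw [integral_toReal hFm.aemeasurable hFfin]
    exact ENNReal.toReal_le_of_le_ofReal (by positivity) hFint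
  filter_upwards [hFfin, hGc] with z hzF hzG hseg
  have hlim : ∀ s ∈ Icc 0 δ, Tendsto (fun k => U k (z + s • v)) atTop (𝓝 (u (z + s • v))) := by
    intro s hs
    have hWs : W ∈ 𝓝 (z + s • v) := mem_of_superset (hPo.mem_nhds (hseg s hs)) hPW
    have hca : ContinuousAt (W.indicator u) (z + s • v) :=
      (huc.continuousAt (mem_of_superset hWs hWD)).congr
        (by filter_upwards [hWs] with y hy using (indicator_of_mem hy u).symm)
    have := tendsto_mollify_of_continuousAt hρ huW.locallyIntegrable hca
    rwa [indicator_of_mem (hPW (hseg s hs))] at this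
  have h0mem : (0 : ℝ) ∈ Icc 0 δ := left_mem_Icc.2 hδ.le
  have hlim0 : Tendsto (fun k => U k z) atTop (𝓝 (u z)) := by simpa using hlim 0 h0mem
  have hlimδ := hlim δ (right_mem_Icc.2 hδ.le)
  have hzP : z ∈ P := by simpa using hseg 0 h0mem
  have hd1 : ∀ k, ∀ s ∈ Icc 0 δ, HasDerivAt (fun s : ℝ => U k (z + s • v))
      (dirDeriv v (U k) (z + s • v)) s := by
    intro k s _
    have hl : HasDerivAt (fun s : ℝ => z + s • v) v s := by
      simpa using ((hasDerivAt_id s).smul_const v).const_add z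
    exact ((hUs k).differentiable (by simp) _).hasFDerivAt.comp_hasDerivAt s hl
  have hd2 : ∀ k, ∀ s ∈ Icc 0 δ, HasDerivAt (fun s : ℝ => dirDeriv v (U k) (z + s • v))
      (m k (z + s • v)) s := by
    intro k s hs
    have hl : HasDerivAt (fun s : ℝ => z + s • v) v s := by
      simpa using ((hasDerivAt_id s).smul_const v).const_add z
    have := ((contDiff_dirDeriv (hUs k) v).differentiable (by simp)
      (z + s • v)).hasFDerivAt.comp_hasDerivAt s hl
    rw [hm]
    simp only []
    rw [← dirDeriv_dirDeriv_mollify_spaceDir hgrad hhess hW hWD huW hPo (hPk k) (hseg s hs) e]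
    exact this
  have hcm : ∀ k, Continuous fun s : ℝ => m k (z + s • v) := fun k =>
    (hmc k).comp (by fun_prop)
  constructor
  · have hT : Tendsto (fun k => ENNReal.ofReal
        (((U k (z + δ • v) - U k z) / δ - dirDeriv v (U k) z) ^ 2)) atTop
        (𝓝 (ENNReal.ofReal (((u (z + δ • v) - u z) / δ - spatialDeriv Du e z) ^ 2))) := by
      refine ENNReal.tendsto_ofReal ((((hlimδ.sub hlim0).div_const δ).sub ?_).pow 2)
      rw [indicator_of_mem (hPW hzP)] at hzG
      refine hzG.congr fun k => ?_
      exact (dirDeriv_mollify_spaceDir hgrad hW hWD huW e (hPk k z hzP)).symm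
    have hle : ENNReal.ofReal (((u (z + δ • v) - u z) / δ - spatialDeriv Du e z) ^ 2) ≤ F z := by
      rw [← hT.liminf_eq]
      refine liminf_le_liminf (Eventually.of_forall fun k => ?_)
      rw [← ofReal_mul_intervalIntegral_eq (hmc k) v hδ.le z]
      have := sq_slope_sub_deriv_le (hd1 k) (hd2 k) (hcm k) hδ
      simp only [zero_smul, add_zero] at this
      exact ENNReal.ofReal_le_ofReal this
    exact (ENNReal.ofReal_le_iff_le_toReal hzF.ne).1 hle
  · intro ε s hε hs hrise hout
    refine (ENNReal.ofReal_le_iff_le_toReal hzF.ne).1 ?_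
    refine le_liminf_of_le (by isBoundedDefault) ?_
    have hev1 : ∀ᶠ k in atTop, U k z + ε * δ < U k (z + δ • v) :=
      (hlim0.add_const (ε * δ)).eventually_lt hlimδ hrise
    have hev2 : ∀ᶠ k in atTop, U k (z + s • v) < U k z ∨ U k (z + δ • v) < U k (z + s • v) := by
      rcases hout with h | h
      · exact ((hlim s hs).eventually_lt hlim0 h).mono fun k hk => Or.inl hk
      · exact (hlimδ.eventually_lt (hlim s hs) h).mono fun k hk => Or.inr hk
    filter_upwards [hev1, hev2] with k hk1 hk2
    rw [← ofReal_mul_intervalIntegral_eq (hmc k) v hδ.le z]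
    refine ENNReal.ofReal_le_ofReal (sq_le_of_notMem_Icc (hd1 k) (hd2 k) (hcm k) hε hs ?_ ?_)
    · simpa using hk1
    · simpa using hk2

end Oscillation

end Approximants

section DiffQuot

variable {n : ℕ}

/-! ### Kato's inequality for difference quotients -/

lemma dirDeriv_diffQuot {f : SpaceTime n → ℝ} (hf : ContDiff ℝ ∞ f) (a w : SpaceTime n) (δ : ℝ) :
    dirDeriv w (fun z => (f (z + a) - f z) / δ) =
      fun z => (dirDeriv w f (z + a) - dirDeriv w f z) / δ := by
  ext z
  have h1 : HasFDerivAt (fun z => f (z + a)) (fderiv ℝ f (z + a)) z :=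
    (hasFDerivAt_comp_add_right a).2 (hf.differentiable (by simp) _).hasFDerivAt
  have h2 : HasFDerivAt (fun z => (f (z + a) - f z) / δ)
      (δ⁻¹ • (fderiv ℝ f (z + a) - fderiv ℝ f z)) z := by
    simp only [div_eq_inv_mul]
    exact (h1.sub (hf.differentiable (by simp) z).hasFDerivAt).const_mul δ⁻¹
  rw [dirDeriv, h2.fderiv]
  simp [dirDeriv, div_eq_inv_mul]

lemma heat_diffQuot {f : SpaceTime n → ℝ} (hf : ContDiff ℝ ∞ f) (a : SpaceTime n) (δ : ℝ)
    (z : SpaceTime n) :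
    heat (fun z => (f (z + a) - f z) / δ) z = (heat f (z + a) - heat f z) / δ := by
  simp only [heat, dirDeriv_diffQuot hf, dirDeriv_diffQuot (contDiff_dirDeriv hf _),
    ← Finset.sum_div, Finset.sum_sub_distrib]
  ring

section Core

variable {D W P : Set (SpaceTime n)} {u : SpaceTime n → ℝ} {Du : Fin n → SpaceTime n → ℝ}
  {D2u : Fin n → Fin n → SpaceTime n → ℝ} {ut g η : SpaceTime n → ℝ}

/-- Kato's inequality `H[p(w)] ≥ p'(w) H[w]` for the difference quotients `w` of a function with
bounded `H[u] = g`. -/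
lemma integral_diffQuot_le (hgrad : ∀ i, HasWeakDeriv D u (coordDir i) (Du i))
    (hhess : ∀ i j, HasWeakDeriv D (Du i) (coordDir j) (D2u i j))
    (htime : HasWeakDeriv D u timeDir ut) (hg : ∀ z, g z = (∑ i, D2u i i z) - ut z)
    (huc : ContinuousOn u (interior D)) (hW : IsCompact W) (hWD : W ⊆ interior D)
    (hPo : IsOpen P) {ρ : ℝ} (hρ : 0 < ρ) (hP : ∀ z ∈ P, closedBall z ρ ⊆ W)
    (hg1 : ∀ᵐ z, z ∈ W → |g z| ≤ 1) (hη : ContDiff ℝ ∞ η) (hηc : HasCompactSupport η)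
    (hη0 : ∀ z, 0 ≤ η z) {a : SpaceTime n} {δ : ℝ}
    (hK : ∀ z ∈ tsupport η, z ∈ P ∧ z + a ∈ P) {ε : ℝ} {p p' p'' : ℝ → ℝ}
    (hp : IsPosPartApprox ε p p' p'') :
    ∫ z, p' ((u (z + a) - u z) / δ) * ((g (z + a) - g z) / δ) * η z ≤
      ∫ z, p ((u (z + a) - u z) / δ) * adjointHeat η z := by
  have hPW : P ⊆ W := fun z hz => hP z hz (mem_closedBall_self hρ.le)
  have huW : Integrable (W.indicator u) :=
    ((huc.mono hWD).integrableOn_compact hW).integrable_indicator hW.measurableSet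
  have hgW : Integrable (W.indicator g) := by
    have : g = fun z => (∑ i, D2u i i z) - ut z := funext hg
    rw [integrable_indicator_iff hW.measurableSet, this]
    exact (integrable_finsetSum _ fun i _ =>
      ((hhess i i).2.1.integrableOn_compact_subset hWD hW)).sub
      (htime.2.1.integrableOn_compact_subset hWD hW)
  obtain ⟨C, hC⟩ := hW.exists_bound_of_continuousOn (huc.mono hWD)
  have hC' : ∀ᵐ z, |W.indicator u z| ≤ max C 0 := Eventually.of_forall fun z => by
    by_cases hz : z ∈ W
    · simpa [hz] using Or.inl (hC z hz)
    · simp [hz]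
  have hg1' : ∀ᵐ z, |W.indicator g z| ≤ 1 := by
    filter_upwards [hg1] with z hz
    by_cases h : z ∈ W
    · simpa [h] using hz h
    · simp [h]
  set U : ℕ → SpaceTime n → ℝ := fun k => mollify (bumpSeq n hρ k) (W.indicator u) with hU
  set G : ℕ → SpaceTime n → ℝ := fun k => mollify (bumpSeq n hρ k) (W.indicator g) with hG
  have hUs : ∀ k, ContDiff ℝ ∞ (U k) := fun k => contDiff_mollify huW.locallyIntegrable
  have hGs : ∀ k, Continuous (G k) := fun k => (contDiff_mollify hgW.locallyIntegrable).continuous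
  have hPk : ∀ k, ∀ z ∈ P, closedBall z (bumpSeq n hρ k).rOut ⊆ W := fun k z hz =>
    (closedBall_subset_closedBall (bumpSeq_rOut_le hρ k)).trans (hP z hz)
  have hUlim : ∀ z ∈ P, Tendsto (fun k => U k z) atTop (𝓝 (u z)) := by
    intro z hz
    have hWz : W ∈ 𝓝 z := mem_of_superset (hPo.mem_nhds hz) hPW
    have hca : ContinuousAt (W.indicator u) z :=
      (huc.continuousAt (mem_of_superset hWz hWD)).congr
        (by filter_upwards [hWz] with y hy using (indicator_of_mem hy u).symm)
    have := tendsto_mollify_of_continuousAt hρ huW.locallyIntegrable hca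
    rwa [indicator_of_mem (hPW hz)] at this
  have hGlim : ∀ᵐ z, z ∈ P → Tendsto (fun k => G k z) atTop (𝓝 (g z)) := by
    filter_upwards [ae_tendsto_mollify hρ hgW.locallyIntegrable] with z hz hzP
    rwa [indicator_of_mem (hPW hzP)] at hz
  have hGlim' : ∀ᵐ z, z + a ∈ P → Tendsto (fun k => G k (z + a)) atTop (𝓝 (g (z + a))) :=
    (quasiMeasurePreserving_add_right (volume : Measure (SpaceTime n)) a).ae hGlim
  set V : ℕ → SpaceTime n → ℝ := fun k z => (U k (z + a) - U k z) / δ with hV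
  have hVs : ∀ k, ContDiff ℝ ∞ (V k) := fun k =>
    (((hUs k).comp (contDiff_id.add contDiff_const)).sub (hUs k)).div_const δ
  have hVlim : ∀ z ∈ tsupport η, Tendsto (fun k => V k z) atTop (𝓝 ((u (z + a) - u z) / δ)) :=
    fun z hz => ((hUlim _ (hK z hz).2).sub (hUlim _ (hK z hz).1)).div_const δ
  have hVb : ∀ k z, |V k z| ≤ (max C 0 + max C 0) / |δ| := by
    intro k z
    rw [hV, abs_div]
    gcongr
    exact (abs_sub _ _).trans (add_le_add (abs_mollify_le hC' _) (abs_mollify_le hC' _))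
  have hkato : ∀ k, ∫ z, p' (V k z) * ((G k (z + a) - G k z) / δ) * η z ≤
      ∫ z, p (V k z) * adjointHeat η z := by
    intro k
    refine le_trans (le_of_eq ?_) (integral_comp_mul_heat_le hp (hVs k) hη hηc hη0)
    refine integral_congr_ae (Eventually.of_forall fun z => ?_)
    by_cases hz : z ∈ tsupport η
    · have hgf : g = fun z => (∑ i, D2u i i z) - ut z := funext hg
      simp only [hV, heat_diffQuot (hUs k)]
      rw [hU, heat_mollify hgrad hhess htime hW hWD huW hPo (hPk k) (hK z hz).1,
        heat_mollify hgrad hhess htime hW hWD huW hPo (hPk k) (hK z hz).2, ← hgf]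
    · simp [image_eq_zero_of_notMem_tsupport hz]
  have hL : Tendsto (fun k => ∫ z, p' (V k z) * ((G k (z + a) - G k z) / δ) * η z) atTop
      (𝓝 (∫ z, p' ((u (z + a) - u z) / δ) * ((g (z + a) - g z) / δ) * η z)) := by
    refine tendsto_integral_of_dominated_convergence (fun z => (1 + 1) / |δ| * η z)
      (fun k => Continuous.aestronglyMeasurable ?_)
      ((hη.continuous.integrable_of_hasCompactSupport hηc).const_mul _)
      (fun k => Eventually.of_forall fun z => ?_) ?_
    · exact ((hp.continuous'.comp (hVs k).continuous).mul
        ((((hGs k).comp (continuous_id.add continuous_const)).sub (hGs k)).div_const δ)).mul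
        hη.continuous
    · rw [norm_mul, norm_mul, Real.norm_of_nonneg (hη0 z), Real.norm_of_nonneg (hp.nonneg' _),
        Real.norm_eq_abs, abs_div]
      refine mul_le_mul_of_nonneg_right ?_ (hη0 z)
      rw [← one_mul ((1 + 1) / |δ|)]
      refine mul_le_mul (hp.le_one' _) ?_ (by positivity) zero_le_one
      gcongr
      exact (abs_sub _ _).trans (add_le_add (abs_mollify_le hg1' _) (abs_mollify_le hg1' _))
    · filter_upwards [hGlim, hGlim'] with z h1 h2
      by_cases hz : z ∈ tsupport η
      · exact (((hp.continuous'.tendsto _).comp (hVlim z hz)).mul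
          (((h2 (hK z hz).2).sub (h1 (hK z hz).1)).div_const δ)).mul_const _
      · simp [image_eq_zero_of_notMem_tsupport hz]
  have hA := contDiff_adjointHeat hη
  have hAc := hasCompactSupport_adjointHeat hηc
  have hR : Tendsto (fun k => ∫ z, p (V k z) * adjointHeat η z) atTop
      (𝓝 (∫ z, p ((u (z + a) - u z) / δ) * adjointHeat η z)) := by
    refine tendsto_integral_of_dominated_convergence
      (fun z => ((max C 0 + max C 0) / |δ| + |p 0|) * |adjointHeat η z|)
      (fun k => Continuous.aestronglyMeasurable ?_)
      ((hA.continuous.integrable_of_hasCompactSupport hAc).abs.const_mul _)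
      (fun k => Eventually.of_forall fun z => ?_) ?_
    · exact (hp.continuous.comp (hVs k).continuous).mul hA.continuous
    · rw [norm_mul, Real.norm_eq_abs, Real.norm_eq_abs]
      refine mul_le_mul_of_nonneg_right ?_ (abs_nonneg _)
      have h1 := hp.abs_sub_le_abs_sub (V k z) 0
      rw [sub_zero] at h1
      have h2 := abs_add_le (p (V k z) - p 0) (p 0)
      rw [sub_add_cancel] at h2
      linarith [hVb k z]
    · refine Eventually.of_forall fun z => ?_
      by_cases hz : z ∈ tsupport η
      · exact ((hp.continuous.tendsto _).comp (hVlim z hz)).mul_const _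
      · simp [adjointHeat_of_notMem_tsupport hz]
  exact le_of_tendsto_of_tendsto' hL hR hkato

lemma nonneg_of_forall_neg_mul_le {X C r : ℝ} (hr : 0 < r)
    (h : ∀ δ, 0 < δ → δ < r → -(C * δ) ≤ X) : 0 ≤ X := by
  have ht : Tendsto (fun δ : ℝ => -(C * δ)) (𝓝[>] 0) (𝓝 0) := by
    have : Continuous fun δ : ℝ => -(C * δ) := by fun_prop
    simpa using (this.tendsto 0).mono_left nhdsWithin_le_nhds
  refine le_of_tendsto ht ?_
  filter_upwards [Ioo_mem_nhdsGT hr] with δ hδ using h δ hδ.1 hδ.2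

lemma IsPosPartApprox.integrable_comp_mul {ε : ℝ} {p p' p'' : ℝ → ℝ}
    (hp : IsPosPartApprox ε p p' p'') {v A : SpaceTime n → ℝ} (hv : Integrable v)
    (hA : Continuous A) (hAc : HasCompactSupport A) : Integrable fun z => p (v z) * A z := by
  obtain ⟨B, hB⟩ := hAc.exists_bound_of_continuous hA
  have hAi := hA.integrable_of_hasCompactSupport hAc (μ := volume)
  refine ((hv.abs.mul_const B).add (hAi.abs.const_mul |p 0|)).mono'
    ((hp.continuous.comp_aestronglyMeasurable hv.1).mul hA.aestronglyMeasurable)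
    (Eventually.of_forall fun z => ?_)
  have h1 := hp.abs_sub_le_abs_sub (v z) 0
  rw [sub_zero] at h1
  have h2 := abs_add_le (p (v z) - p 0) (p 0)
  rw [sub_add_cancel] at h2
  have h3 : |p (v z)| ≤ |v z| + |p 0| := by linarith
  rw [norm_mul, Real.norm_eq_abs, Real.norm_eq_abs, Pi.add_apply]
  calc |p (v z)| * |A z| ≤ (|v z| + |p 0|) * |A z| :=
        mul_le_mul_of_nonneg_right h3 (abs_nonneg _)
    _ = |v z| * |A z| + |p 0| * |A z| := add_mul _ _ _
    _ ≤ |v z| * B + |p 0| * |A z| := by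
        gcongr
        exact hB z

/-- Let `H[u] = h` with `|h| ≤ 1`, and suppose that `h` does not decrease over a segment in the
direction `e` on which `u` stays between its end values. Then `(D_e u)₊` is sub-caloric: the segments
over which `h` decreases although `u` rises with slope more than `ε` start in a set of measure `O(δ²)`,
where `δ` is their length. -/
lemma integral_posPart_mul_adjointHeat_nonneg
    (hgrad : ∀ i, HasWeakDeriv D u (coordDir i) (Du i))
    (hhess : ∀ i j, HasWeakDeriv D (Du i) (coordDir j) (D2u i j))
    (htime : HasWeakDeriv D u timeDir ut) (huc : ContinuousOn u (interior D))
    (hW : IsCompact W) (hWD : W ⊆ interior D) (hPo : IsOpen P) {ρ : ℝ} (hρ : 0 < ρ)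
    (hP : ∀ z ∈ P, closedBall z ρ ⊆ W) (e : EuclideanSpace ℝ (Fin n))
    (hL2 : Integrable fun z => W.indicator (spatialHess D2u e) z ^ 2)
    {h : SpaceTime n → ℝ} (hh : ∀ᵐ z, z ∈ W → (∑ i, D2u i i z) - ut z = h z)
    (hh1 : ∀ z ∈ W, |h z| ≤ 1)
    (hmono : ∀ z, ∀ δ > (0 : ℝ), (∀ s ∈ Icc 0 δ, z + s • spaceDir e ∈ P) →
      (∀ s ∈ Icc 0 δ, u (z + s • spaceDir e) ∈ Icc (u z) (u (z + δ • spaceDir e))) →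
      h z ≤ h (z + δ • spaceDir e))
    (hη : ContDiff ℝ ∞ η) (hηc : HasCompactSupport η) (hη0 : ∀ z, 0 ≤ η z) {r : ℝ} (hr : 0 < r)
    (hK : ∀ z ∈ tsupport η, ∀ s ∈ Ico 0 r, z + s • spaceDir e ∈ P) :
    0 ≤ ∫ z, max (spatialDeriv Du e z) 0 * adjointHeat η z := by
  set v := spaceDir e with hv
  have hPW : P ⊆ W := fun z hz => hP z hz (mem_closedBall_self hρ.le)
  have hKP : tsupport η ⊆ P := fun z hz => by simpa using hK z hz 0 ⟨le_rfl, hr⟩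
  set g : SpaceTime n → ℝ := fun z => (∑ i, D2u i i z) - ut z with hg
  have hg1 : ∀ᵐ z, z ∈ W → |g z| ≤ 1 := by
    filter_upwards [hh] with z hz hzW
    rw [show g z = h z from hz hzW]
    exact hh1 z hzW
  set M := ∫ z, W.indicator (spatialHess D2u e) z ^ 2 with hM
  set w := W.indicator (spatialDeriv Du e) with hw
  have hwi : Integrable w := integrable_indicator_spatialDeriv hgrad hW hWD e
  have hA := (contDiff_adjointHeat hη).continuous
  have hAc := hasCompactSupport_adjointHeat hηc
  have hAi : Integrable (adjointHeat η) := hA.integrable_of_hasCompactSupport hAc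
  obtain ⟨B, hB⟩ := hηc.exists_bound_of_continuous hη.continuous
  obtain ⟨B', hB'⟩ := hAc.exists_bound_of_continuous hA
  have hB0 : 0 ≤ B := (norm_nonneg _).trans (hB 0)
  have hB0' : 0 ≤ B' := (norm_nonneg _).trans (hB' 0)
  have hKm : MeasurableSet (tsupport η) := (isClosed_tsupport η).measurableSet
  set κ : SpaceTime n → ℝ := (tsupport η).indicator 1 with hκ
  have hκi : Integrable κ := (integrable_indicator_iff hKm).2
    (integrableOn_const hηc.measure_lt_top.ne)
  have hwη : ∀ F : ℝ → ℝ, ∀ z, F (spatialDeriv Du e z) * adjointHeat η z =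
      F (w z) * adjointHeat η z := by
    intro F z
    by_cases hz : z ∈ tsupport η
    · rw [hw, indicator_of_mem (hPW (hKP hz))]
    · simp [adjointHeat_of_notMem_tsupport hz]
  have hmaxi : Integrable fun z => max (w z) 0 * adjointHeat η z :=
    hwi.pos_part.mul_bdd (c := B') hA.aestronglyMeasurable (Eventually.of_forall hB')
  simp only [hwη fun s => max s 0]
  -- The smooth approximations come first, where `D_e u` is a limit of difference quotients: the
  -- errors are `O(δ)` for fixed `ε`.
  have key : ∀ ε > 0, ∀ p p' p'', IsPosPartApprox ε p p' p'' →
      0 ≤ ∫ z, p (w z) * adjointHeat η z := by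
    intro ε hε p p' p'' hp
    refine nonneg_of_forall_neg_mul_le (C := 2 * B * M / ε ^ 2 + B' * (M + ∫ z, κ z)) hr
      fun δ hδ hδr => ?_
    obtain ⟨R, hRi, hR0, hRM, hR⟩ :=
      exists_oscillation_bound hgrad hhess huc hW hWD hPo hρ hP e hL2 hδ
    have hseg : ∀ z ∈ tsupport η, ∀ s ∈ Icc 0 δ, z + s • v ∈ P := fun z hz s hs =>
      hK z hz s ⟨hs.1, hs.2.trans_lt hδr⟩
    have hend : ∀ z ∈ tsupport η, z ∈ P ∧ z + δ • v ∈ P := fun z hz =>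
      ⟨hKP hz, hseg z hz δ (right_mem_Icc.2 hδ.le)⟩
    have hkato := integral_diffQuot_le (g := g) (δ := δ) hgrad hhess htime (fun z => rfl) huc hW
      hWD hPo hρ hP hg1 hη hηc hη0 hend hp
    -- `h` decreases over a segment of slope at least `ε` only where `R ≥ ε²`.
    have hlow : -(2 * B / (δ * ε ^ 2) * ∫ z, R z) ≤
        ∫ z, p' ((u (z + δ • v) - u z) / δ) * ((g (z + δ • v) - g z) / δ) * η z := by
      have hae : ∀ᵐ z, -(2 * B / (δ * ε ^ 2) * R z) ≤
          p' ((u (z + δ • v) - u z) / δ) * ((g (z + δ • v) - g z) / δ) * η z := by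
        have hh' := (quasiMeasurePreserving_add_right (volume : Measure (SpaceTime n))
          (δ • v)).ae hh
        filter_upwards [hh, hh', hR] with z e1 e2 e3
        have hnp : -(2 * B / (δ * ε ^ 2) * R z) ≤ 0 :=
          neg_nonpos.2 (mul_nonneg (by positivity) (hR0 z))
        by_cases hz : z ∈ tsupport η
        swap
        · simpa [image_eq_zero_of_notMem_tsupport hz] using hnp
        have hzW := hPW (hend z hz).1
        have hzW' := hPW (hend z hz).2
        have e1' : g z = h z := e1 hzW
        have e2' : g (z + δ • v) = h (z + δ • v) := e2 hzW'
        rw [e1', e2']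
        rcases le_or_gt ((u (z + δ • v) - u z) / δ) ε with hle | hgt
        · rw [hp.eq_zero' _ hle]
          simpa using hnp
        by_cases hdec : h z ≤ h (z + δ • v)
        · refine hnp.trans (mul_nonneg (mul_nonneg (hp.nonneg' _) ?_) (hη0 z))
          exact div_nonneg (sub_nonneg.2 hdec) hδ.le
        have hrise : u z + ε * δ < u (z + δ • v) := by
          rw [lt_div_iff₀ hδ] at hgt
          linarith
        have hRz : ε ^ 2 ≤ R z := by
          by_contra hcon
          refine hdec (hmono z δ hδ (hseg z hz) fun s hs => ?_)
          by_contra hout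
          refine hcon ((e3 (hseg z hz)).2 ε s hε.le hs hrise ?_)
          rw [mem_Icc, not_and_or, not_le, not_le] at hout
          exact hout
        have hηB : η z ≤ B := (le_abs_self _).trans (hB z)
        have hd : |(h (z + δ • v) - h z) / δ| ≤ 2 / δ := by
          rw [abs_div, abs_of_pos hδ]
          gcongr
          exact (abs_sub _ _).trans (by linarith [hh1 z hzW, hh1 _ hzW'])
        have habs : |p' ((u (z + δ • v) - u z) / δ) * ((h (z + δ • v) - h z) / δ) * η z| ≤
            2 / δ * B := by
          rw [abs_mul, abs_mul, abs_of_nonneg (hp.nonneg' _), abs_of_nonneg (hη0 z)]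
          refine mul_le_mul ?_ hηB (hη0 z) (by positivity)
          exact (mul_le_mul (hp.le_one' _) hd (abs_nonneg _) zero_le_one).trans_eq (one_mul _)
        have hRB : 2 / δ * B ≤ 2 * B / (δ * ε ^ 2) * R z := by
          have : 2 / δ * B = 2 * B / (δ * ε ^ 2) * ε ^ 2 := by field_simp
          rw [this]
          exact mul_le_mul_of_nonneg_left hRz (by positivity)
        linarith [neg_abs_le (p' ((u (z + δ • v) - u z) / δ) *
          ((h (z + δ • v) - h z) / δ) * η z)]
      rw [← integral_const_mul, ← integral_neg]
      by_cases hi : Integrable fun z =>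
          p' ((u (z + δ • v) - u z) / δ) * ((g (z + δ • v) - g z) / δ) * η z
      · exact integral_mono_ae (hRi.const_mul _).neg hi hae
      · rw [integral_undef hi, integral_neg]
        exact neg_nonpos.2 (integral_nonneg fun z => mul_nonneg (by positivity) (hR0 z))
    -- The difference quotient is `L¹`-close to the derivative.
    have hup : ∫ z, p ((u (z + δ • v) - u z) / δ) * adjointHeat η z ≤
        (∫ z, p (w z) * adjointHeat η z) + B' * ((1 / δ) * (∫ z, R z) + δ * ∫ z, κ z) := by
      have hpi := hp.integrable_comp_mul hwi hA hAc
      have hei : Integrable fun z => B' * ((1 / δ) * R z + δ * κ z) :=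
        ((hRi.const_mul _).add (hκi.const_mul _)).const_mul _
      have hae : ∀ᵐ z, |p ((u (z + δ • v) - u z) / δ) * adjointHeat η z -
          p (w z) * adjointHeat η z| ≤ B' * ((1 / δ) * R z + δ * κ z) := by
        filter_upwards [hR] with z hRz
        by_cases hz : z ∈ tsupport η
        · have h1 := (hRz (hseg z hz)).1
          have hwz : w z = spatialDeriv Du e z := indicator_of_mem (hPW (hKP hz)) _
          have hκz : κ z = 1 := by simp [hκ, hz]
          rw [← hwz] at h1
          rw [← sub_mul, abs_mul, mul_comm, hκz, mul_one]
          refine mul_le_mul (hB' z) ?_ (abs_nonneg _) hB0'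
          refine (hp.abs_sub_le_abs_sub _ _).trans ?_
          set x := (u (z + δ • v) - u z) / δ - w z
          -- By the inequality of arithmetic and geometric means, `|x| ≤ x² / δ + δ`.
          have hx : |x| * δ ≤ R z + δ * δ := by
            nlinarith [sq_abs x, sq_nonneg (|x| - δ), abs_nonneg x, hδ]
          have : |x| ≤ (R z + δ * δ) / δ := (le_div_iff₀ hδ).2 hx
          refine this.trans_eq ?_
          field_simp
        · rw [adjointHeat_of_notMem_tsupport hz]
          simp only [mul_zero, sub_self, abs_zero]
          refine mul_nonneg hB0' (add_nonneg (mul_nonneg (by positivity) (hR0 z))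
            (mul_nonneg hδ.le (indicator_nonneg (fun _ _ => zero_le_one) z)))
      have hsum : (∫ z, p (w z) * adjointHeat η z) + B' * ((1 / δ) * (∫ z, R z) + δ * ∫ z, κ z) =
          ∫ z, (p (w z) * adjointHeat η z + B' * ((1 / δ) * R z + δ * κ z)) := by
        rw [integral_add hpi hei, integral_const_mul,
          integral_add (hRi.const_mul _) (hκi.const_mul _), integral_const_mul, integral_const_mul]
      rw [hsum]
      have hi : Integrable fun z => p ((u (z + δ • v) - u z) / δ) * adjointHeat η z := by
        have huW : Integrable (W.indicator u) :=
          ((huc.mono hWD).integrableOn_compact hW).integrable_indicator hW.measurableSet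
        refine (hp.integrable_comp_mul
          (((huW.comp_add_right (δ • v)).sub huW).div_const δ) hA hAc).congr
          (Eventually.of_forall fun z => ?_)
        by_cases hz : z ∈ tsupport η
        · simp [hPW (hend z hz).1, hPW (hend z hz).2]
        · simp [adjointHeat_of_notMem_tsupport hz]
      refine integral_mono_ae hi (hpi.add hei) ?_
      filter_upwards [hae] with z hz
      linarith [le_abs_self (p ((u (z + δ • v) - u z) / δ) * adjointHeat η z -
        p (w z) * adjointHeat η z)]
    have hRδ : 1 / δ * (∫ z, R z) ≤ δ * M := by
      have := mul_le_mul_of_nonneg_left hRM (show 0 ≤ 1 / δ by positivity)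
      rw [← hM] at this
      refine this.trans_eq ?_
      field_simp
    have h1 : 2 * B / (δ * ε ^ 2) * (∫ z, R z) ≤ 2 * B * M / ε ^ 2 * δ := by
      have := mul_le_mul_of_nonneg_left hRδ (show 0 ≤ 2 * B / ε ^ 2 by positivity)
      calc 2 * B / (δ * ε ^ 2) * (∫ z, R z) = 2 * B / ε ^ 2 * (1 / δ * ∫ z, R z) := by
            field_simp
        _ ≤ 2 * B / ε ^ 2 * (δ * M) := this
        _ = 2 * B * M / ε ^ 2 * δ := by ring
    have h2 : B' * ((1 / δ) * (∫ z, R z) + δ * ∫ z, κ z) ≤ B' * (M + ∫ z, κ z) * δ := by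
      calc B' * ((1 / δ) * (∫ z, R z) + δ * ∫ z, κ z) ≤ B' * (δ * M + δ * ∫ z, κ z) := by gcongr
        _ = B' * (M + ∫ z, κ z) * δ := by ring
    linarith
  refine nonneg_of_forall_neg_mul_le (C := 2 * ∫ z, |adjointHeat η z|) one_pos fun ε hε _ => ?_
  obtain ⟨p, p', p'', hp⟩ := exists_isPosPartApprox hε
  have hpi := hp.integrable_comp_mul hwi hA hAc
  have hle : ∫ z, p (w z) * adjointHeat η z ≤
      ∫ z, (max (w z) 0 * adjointHeat η z + 2 * ε * |adjointHeat η z|) := by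
    refine integral_mono hpi (hmaxi.add (hAi.abs.const_mul _)) fun z => ?_
    have h1 : |p (w z) * adjointHeat η z - max (w z) 0 * adjointHeat η z| ≤
        2 * ε * |adjointHeat η z| := by
      rw [← sub_mul, abs_mul]
      exact mul_le_mul_of_nonneg_right (hp.abs_sub_le _) (abs_nonneg _)
    linarith [le_abs_self (p (w z) * adjointHeat η z - max (w z) 0 * adjointHeat η z)]
  rw [integral_add hmaxi (hAi.abs.const_mul _), integral_const_mul] at hle
  linarith [key ε hε p p' p'' hp]

end Core

end DiffQuot

section Conclusion

variable {n : ℕ}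

/-! ### Sub-caloricity of the directional derivatives -/

lemma integrable_sq_indicator_spatialHess {D W : Set (SpaceTime n)} {q : ℝ≥0∞} (hq : 2 ≤ q)
    {D2u : Fin n → Fin n → SpaceTime n → ℝ}
    (hhess : ∀ i j, MemLp (D2u i j) q (volume.restrict D)) (hW : IsCompact W) (hWD : W ⊆ D)
    (e : EuclideanSpace ℝ (Fin n)) :
    Integrable fun z => W.indicator (spatialHess D2u e) z ^ 2 := by
  have : IsFiniteMeasure (volume.restrict W) := ⟨by simpa using hW.measure_lt_top⟩
  have h2 : ∀ i j, MemLp (D2u i j) 2 (volume.restrict W) := fun i j =>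
    ((hhess i j).mono_measure (Measure.restrict_mono hWD le_rfl)).mono_exponent hq
  have h3 : MemLp (spatialHess D2u e) 2 (volume.restrict W) :=
    memLp_finsetSum _ fun i _ => (memLp_finsetSum _ fun j _ => (h2 i j).const_mul _).const_mul _
  refine ((integrable_indicator_iff hW.measurableSet).2 h3.integrable_sq).congr
    (Eventually.of_forall fun z => ?_)
  by_cases hz : z ∈ W <;> simp [hz]

lemma subCaloricOn_posPart_spatialDeriv {U : Set (EuclideanSpace ℝ (Fin n))} (hU : IsOpen U)
    {T α β : ℝ} (hαβ : α < β) {q : ℝ≥0∞} {h₀ : EuclideanSpace ℝ (Fin n) → ℝ}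
    {u : SpaceTime n → ℝ} {Du : Fin n → SpaceTime n → ℝ} {D2u : Fin n → Fin n → SpaceTime n → ℝ}
    {ut : SpaceTime n → ℝ} (hu : IsStrongSolution U T α β q h₀ u Du D2u ut)
    {e : EuclideanSpace ℝ (Fin n)} (he : ‖e‖ = 1) :
    SubCaloricOn (fun z => max (spatialDeriv Du e z) 0)
      (cylinder U T \ verticalPart U T α β h₀ u) := by
  have hGQ : interior (cylinder U T \ verticalPart U T α β h₀ u) ⊆ interior (cylinder U T) :=
    interior_mono sdiff_subset
  have hsob := hu.sobolev
  constructor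
  · rw [locallyIntegrableOn_iff isOpen_interior.isLocallyClosed]
    intro k hkG hk
    have : IntegrableOn (spatialDeriv Du e) k := integrable_finsetSum _ fun i _ =>
      ((hsob.weak_grad i).2.1.integrableOn_compact_subset (hkG.trans hGQ) hk).const_mul _
    exact this.pos_part
  rintro η ⟨hη, hηc, hηG⟩ hη0
  obtain ⟨R, hR, hRG⟩ := hηc.isCompact.exists_cthickening_subset_open isOpen_interior hηG
  have hR2 : 0 < R / 2 := half_pos hR
  -- The `R / 2`-neighbourhood of `P` lies in `W`, so mollification at smaller scales commutes with
  -- weak derivatives on `P`; segments of length less than `R / 2` from the support of `η` stay in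
  -- `P`.
  set W := cthickening R (tsupport η) with hW
  have hWc : IsCompact W := hηc.isCompact.cthickening
  have hWD : W ⊆ interior (cylinder U T) := hRG.trans hGQ
  set P := thickening (R / 2) (tsupport η) with hP
  have hPW : ∀ z ∈ P, closedBall z (R / 2) ⊆ W := by
    intro z hz y hy
    obtain ⟨k, hk, hzk⟩ := mem_thickening_iff.1 hz
    refine mem_cthickening_of_dist_le y k R _ hk ?_
    linarith [dist_triangle y z k, mem_closedBall.1 hy]
  have hPG : P ⊆ interior (cylinder U T \ verticalPart U T α β h₀ u) := fun z hz =>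
    hRG (hPW z hz (mem_closedBall_self hR2.le))
  have hve : ‖spaceDir e‖ = 1 := by simp [spaceDir, Prod.norm_def, he]
  have hq : 2 ≤ q := le_trans (by simp) hu.exponent.le
  have heq := (ae_restrict_iff' (hU.measurableSet.prod measurableSet_Ioc)).1 hu.equation
  refine integral_posPart_mul_adjointHeat_nonneg hsob.weak_grad hsob.weak_hess hsob.weak_time
    (hu.continuousOn.mono (interior_subset.trans subset_closure)) hWc hWD isOpen_thickening hR2
    hPW e (integrable_sq_indicator_spatialHess hq hsob.memLp_hess hWc
      (hWD.trans interior_subset) e) (h := hyst U T α β h₀ u) ?_ ?_ ?_ hη hηc hη0 hR2 ?_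
  · filter_upwards [heq] with z hz hzW using hz (interior_subset (hWD hzW))
  · intro z hz
    rcases hyst_eq_or hu.continuousOn hu.initial (interior_subset (hWD hz)) with h | h <;>
      simp [h]
  · intro z δ hδ hseg hval
    have hmem : ∀ s ∈ Icc (0 : ℝ) 1, s * δ ∈ Icc 0 δ := fun s hs =>
      ⟨mul_nonneg hs.1 hδ.le, mul_le_of_le_one_left hδ.le hs.2⟩
    refine hyst_le_hyst_of_forall_mem_Icc hαβ hu.continuousOn hu.initial (fun s hs => ?_)
      fun s hs => ?_
    · rw [smul_smul]
      exact hPG (hseg _ (hmem s hs))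
    · rw [smul_smul]
      exact hval _ (hmem s hs)
  · intro z hz s hs
    refine mem_thickening_iff.2 ⟨z, hz, ?_⟩
    rw [dist_eq_norm, add_sub_cancel_left, norm_smul, hve, mul_one, Real.norm_of_nonneg hs.1]
    exact hs.2

end Conclusion

end Hysteresis

end

theorem mainTheorem4 {n : ℕ} (U : Set (EuclideanSpace ℝ (Fin n))) (hU : IsOpen U)
    (hUconn : IsConnected U) (T : ℝ) (hT : 0 < T) (α β : ℝ) (hαβ : α < β) (q : ENNReal)
    (h₀ : EuclideanSpace ℝ (Fin n) → ℝ) (u : Hysteresis.SpaceTime n → ℝ)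
    (Du : Fin n → Hysteresis.SpaceTime n → ℝ)
    (D2u : Fin n → Fin n → Hysteresis.SpaceTime n → ℝ) (ut : Hysteresis.SpaceTime n → ℝ)
    (hu : Hysteresis.IsStrongSolution U T α β q h₀ u Du D2u ut)
    (e : EuclideanSpace ℝ (Fin n)) (he : ‖e‖ = 1) :
    Hysteresis.SubCaloricOn (fun z => max (Hysteresis.spatialDeriv Du e z) 0)
        (Hysteresis.cylinder U T \ Hysteresis.verticalPart U T α β h₀ u) ∧
      Hysteresis.SubCaloricOn (fun z => max (-Hysteresis.spatialDeriv Du e z) 0)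
        (Hysteresis.cylinder U T \ Hysteresis.verticalPart U T α β h₀ u) := by
  refine ⟨Hysteresis.subCaloricOn_posPart_spatialDeriv hU hαβ hu he, ?_⟩
  -- The negative part of `D_e u` is the positive part of the derivative in the direction `-e`.
  have h := Hysteresis.subCaloricOn_posPart_spatialDeriv hU hαβ hu
    (show ‖-e‖ = 1 by rw [norm_neg, he])
  simpa [Hysteresis.spatialDeriv] using h
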